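/- Let $T>0$, let $\Omega=(\alpha,\beta)\subset\mathbb R$ be a bounded open interval, and let $\Phi_1,\Phi_2\in C^1(\Omega)$ be semi-convex potentials with bounded derivatives (so $\Phi_i\in W^{1,\infty}(\Omega)$) such that $\partial_x\Phi_1\le\partial_x\Phi_2$ on $\Omega$. Let $\rho^1_0,\rho^2_0$ be initial densities with ordered supports: $y<x$ for a.e. $x\in\{\rho^1_0>0\}$ and a.e. $y\in\{\rho^2_0>0\}$. Let $(\rho^1,\rho^2,p)$ be a weak solution on $[0,T]\times\Omega$ of $$(PME_\infty)\qquad \partial_t\rho^i-\partial_x\big((\partial_x p+\partial_x\Phi_i)\rho^i\big)=0,\qquad i=1,2,$$ with no-flux boundary conditions. That is: $\rho^i\in AC^2([0,T];(\mathcal P^{M_i}(\Omega),W_2))$, where $\mathcal P^{M}(\Omega)$ is the set of nonnegative measures of mass $M$, identified with their densities; $\rho^i|_{t=0}=\rho^i_0$; $\rho^1+\rho^2\le 1$ a.e. in $[0,T]\times\Omega$; $p\in L^2([0,T];H^1(\Omega))$, $p\ge 0$ and $p(1-\rho^1-\rho^2)=0$ a.e. in $[0,T]\times\Omega$; and, for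 $i=1,2$, all $\phi\in C^1([0,T]\times\overline\Omega)$ and all $0\le s<t\le T$, $$-\int_s^t\!\!\int_\Omega\rho^i\,\partial_t\phi\,dx\,d\tau+\int_s^t\!\!\int_\Omega(\partial_xp+\partial_x\Phi_i)\,\partial_x\phi\,\rho^i\,dx\,d\tau=\int_\Omega\rho^i_s\,\phi(s,\cdot)\,dx-\int_\Omega\rho^i_t\,\phi(t,\cdot)\,dx .$$ Suppose that $\rho^i_0=\chi_{A^i_0}$ for nonempty open intervals $A^i_0\subseteq\Omega$, and that the drifts are compressive: $\partial_{xx}^2\Phi_i\ge 0$ on $\Omega$ in the sense of distributions, i.e. $\Phi_i$ is convex ($i=1,2$). Then there are functions $a_i,b_i:[0,T]\to\mathbb R$, $i=1,2$, such that for every $t\in[0,T]$ one has $a_i(t)<b_i(t)$, $(a_i(t),b_i(t))\subseteq\Omega$ and $$\rho^i_t=\chi_{(a_i(t),b_i(t))}\quad\text{a.e. in }\Omega .$$ Moreover, these patches and $p$ form a two-phase Hele-Shaw flow with drifts: $b_2(t)\le a_1(t)$ for all $t\in[0,T]$; the functions $a_i,b_i$ are absolutely continuous on $[0,T]$; and for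 a.e. $t\in(0,T)$ the function $p(t,\cdot)$ has a representative, still written $p$, that is continuous and nonnegative on $\overline\Omega$ and satisfies: * $p=0$ at all points of $\Omega$ outside $(a_1(t),b_1(t))\cup(a_2(t),b_2(t))$, except possibly at the contact point $b_2(t)=a_1(t)$ when the two patches touch; * for $i=1,2$, $p$ is $C^1$ on $(a_i(t),b_i(t))$ and $-\partial_{xx}^2p=\partial_{xx}^2\Phi_i$ there in the sense of distributions; * for $i=1,2$, the endpoints are differentiable at $t$ and, with limits taken from inside the patch, $a_i'(t)=\lim_{x\downarrow a_i(t)}(-\partial_xp-\partial_x\Phi_i)$ and $b_i'(t)=\lim_{x\uparrow b_i(t)}(-\partial_xp-\partial_x\Phi_i)$; * if $b_2(t)=a_1(t)$, then $\lim_{x\downarrow a_1(t)}(\partial_xp+\partial_x\Phi_1)=\lim_{x\uparrow b_2(t)}(\partial_xp+\partial_x\Phi_2)$. -/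

import Mathlib

open MeasureTheory Set Filter Topology
open scoped ENNReal ContDiff

noncomputable section

namespace CrossDiffusion

/-- Smooth test functions with compact support in the open interval `(a, b)`. -/
def IsTestFunction (a b : ℝ) (ψ : ℝ → ℝ) : Prop :=
  ContDiff ℝ ∞ ψ ∧ HasCompactSupport ψ ∧ tsupport ψ ⊆ Ioo a b

/-- The measure on `Ω = (α, β)` with Lebesgue density `f`. -/
def densityMeasure (α β : ℝ) (f : ℝ → ℝ) : Measure ℝ :=
  (volume.restrict (Ioo α β)).withDensity (fun x => ENNReal.ofReal (f x))

/-- The 2-Wasserstein distance between two measures on the line (of equal mass): the square root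
of the infimum of the quadratic cost over all transport plans. -/
def W2 (μ ν : Measure ℝ) : ℝ≥0∞ :=
  (⨅ γ ∈ {γ : Measure (ℝ × ℝ) | γ.map Prod.fst = μ ∧ γ.map Prod.snd = ν},
    ∫⁻ z, ENNReal.ofReal ((z.1 - z.2) ^ 2) ∂γ) ^ (1 / 2 : ℝ)

/-- `ρ ∈ AC²([0,T]; (𝒫^M(Ω), W₂))` for a curve of densities `t ↦ ρ t` on `Ω = (α, β)`:
every `ρ t` is a nonnegative density of mass `M`, and
`W₂(ρ_s, ρ_t) ≤ ∫_s^t g` for all `0 ≤ s ≤ t ≤ T`, for some nonnegative `g ∈ L²(0,T)`. -/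
structure IsAC2Curve (T α β M : ℝ) (ρ : ℝ → ℝ → ℝ) : Prop where
  integrable : ∀ t ∈ Icc 0 T, IntegrableOn (ρ t) (Ioo α β)
  nonneg : ∀ t ∈ Icc 0 T, ∀ᵐ x ∂(volume.restrict (Ioo α β)), 0 ≤ ρ t x
  mass : ∀ t ∈ Icc 0 T, ∫ x in Ioo α β, ρ t x = M
  ac2 : ∃ g : ℝ → ℝ, MemLp g 2 (volume.restrict (Icc 0 T)) ∧ (∀ t, 0 ≤ g t) ∧
    ∀ s t, 0 ≤ s → s ≤ t → t ≤ T →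
      W2 (densityMeasure α β (ρ s)) (densityMeasure α β (ρ t)) ≤
        ENNReal.ofReal (∫ τ in s..t, g τ)

/-- `p ∈ L²([0,T]; H¹(Ω))`, `Ω = (α, β)`, with weak space derivative `dp`. -/
structure IsL2H1 (T α β : ℝ) (p dp : ℝ → ℝ → ℝ) : Prop where
  memLp : MemLp (Function.uncurry p) 2
    ((volume.restrict (Icc 0 T)).prod (volume.restrict (Ioo α β)))
  memLp_deriv : MemLp (Function.uncurry dp) 2
    ((volume.restrict (Icc 0 T)).prod (volume.restrict (Ioo α β)))
  weakDeriv : ∀ᵐ t ∂(volume.restrict (Icc 0 T)), ∀ ψ : ℝ → ℝ, IsTestFunction α β ψ →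
    ∫ x in Ioo α β, p t x * deriv ψ x = -∫ x in Ioo α β, dp t x * ψ x

/-- The weak form of `∂ₜρ - ∂ₓ((∂ₓp + ∂ₓΦ)ρ) = 0` on `[0,T] × Ω` with no-flux boundary condition,
where `dp` stands for `∂ₓp`. The test functions are `C¹` up to the boundary of `[0,T] × Ω`
(restrictions of `C¹` functions on the plane). -/
def SolvesTransport (T α β : ℝ) (Φ : ℝ → ℝ) (dp ρ : ℝ → ℝ → ℝ) : Prop :=
  ∀ φ : ℝ → ℝ → ℝ, ContDiff ℝ 1 (Function.uncurry φ) →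
    ∀ s t : ℝ, 0 ≤ s → s < t → t ≤ T →
      -(∫ τ in s..t, ∫ x in Ioo α β, ρ τ x * deriv (fun r => φ r x) τ)
        + (∫ τ in s..t, ∫ x in Ioo α β, (dp τ x + deriv Φ x) * deriv (φ τ) x * ρ τ x)
      = (∫ x in Ioo α β, ρ s x * φ s x) - ∫ x in Ioo α β, ρ t x * φ t x

/-- Weak solutions `(ρ₁, ρ₂, p)` of `(PME_∞)` on `[0,T] × Ω`, `Ω = (α, β)`, with potentials
`Φ₁, Φ₂`, masses `M₁, M₂` and initial densities `ρ₁₀, ρ₂₀`. -/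
structure IsWeakSolution (T α β M₁ M₂ : ℝ) (Φ₁ Φ₂ ρ₁₀ ρ₂₀ : ℝ → ℝ) (ρ₁ ρ₂ p : ℝ → ℝ → ℝ) :
    Prop where
  ac2_one : IsAC2Curve T α β M₁ ρ₁
  ac2_two : IsAC2Curve T α β M₂ ρ₂
  measurable_one : AEStronglyMeasurable (Function.uncurry ρ₁)
    ((volume.restrict (Icc 0 T)).prod (volume.restrict (Ioo α β)))
  measurable_two : AEStronglyMeasurable (Function.uncurry ρ₂)
    ((volume.restrict (Icc 0 T)).prod (volume.restrict (Ioo α β)))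
  sum_le_one : ∀ᵐ z ∂((volume.restrict (Icc 0 T)).prod (volume.restrict (Ioo α β))),
    ρ₁ z.1 z.2 + ρ₂ z.1 z.2 ≤ 1
  pressure_nonneg : ∀ᵐ z ∂((volume.restrict (Icc 0 T)).prod (volume.restrict (Ioo α β))),
    0 ≤ p z.1 z.2
  complementarity : ∀ᵐ z ∂((volume.restrict (Icc 0 T)).prod (volume.restrict (Ioo α β))),
    p z.1 z.2 * (1 - ρ₁ z.1 z.2 - ρ₂ z.1 z.2) = 0
  initial_one : ρ₁ 0 =ᵐ[volume.restrict (Ioo α β)] ρ₁₀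
  initial_two : ρ₂ 0 =ᵐ[volume.restrict (Ioo α β)] ρ₂₀
  equations : ∃ dp : ℝ → ℝ → ℝ, IsL2H1 T α β p dp ∧
    SolvesTransport T α β Φ₁ dp ρ₁ ∧ SolvesTransport T α β Φ₂ dp ρ₂

/-- A potential on `Ω = (α, β)`: `C¹`, semi-convex, and with bounded derivative
(so that it lies in `W^{1,∞}(Ω)`). -/
structure IsPotential (α β : ℝ) (Φ : ℝ → ℝ) : Prop where
  contDiffOn : ContDiffOn ℝ 1 Φ (Ioo α β)
  semiconvex : ∃ K : ℝ, ConvexOn ℝ (Ioo α β) (fun x => Φ x + K / 2 * x ^ 2)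
  bounded_deriv : ∃ C : ℝ, ∀ x ∈ Ioo α β, |deriv Φ x| ≤ C

/-- The ordered one-dimensional framework: `Ω = (α, β)` is a bounded open interval, the drift
`-∂ₓΦ₁` dominates `-∂ₓΦ₂`, and `{ρ₁₀ > 0}` lies to the right of `{ρ₂₀ > 0}`. -/
structure OrderedSetting (α β : ℝ) (Φ₁ Φ₂ ρ₁₀ ρ₂₀ : ℝ → ℝ) : Prop where
  nonempty : α < β
  potential_one : IsPotential α β Φ₁
  potential_two : IsPotential α β Φ₂
  drift_ordered : ∀ x ∈ Ioo α β, deriv Φ₁ x ≤ deriv Φ₂ x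
  support_ordered : ∀ᵐ x ∂(volume.restrict (Ioo α β)), ∀ᵐ y ∂(volume.restrict (Ioo α β)),
    0 < ρ₁₀ x → 0 < ρ₂₀ y → y < x

/-- `ρ t` is the indicator of the nonempty open interval `(a t, b t) ⊆ (α, β)`
for every `t ∈ [0,T]`. -/
def IsPatch (T α β : ℝ) (ρ : ℝ → ℝ → ℝ) (a b : ℝ → ℝ) : Prop :=
  ∀ t ∈ Icc 0 T, a t < b t ∧ Ioo (a t) (b t) ⊆ Ioo α β ∧
    ρ t =ᵐ[volume.restrict (Ioo α β)] (Ioo (a t) (b t)).indicator 1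

/-- The equation `-∂ₓₓP = ∂ₓₓΦ` inside the patch `(a, b)`, in the sense of distributions,
for a pressure `P` that is `C¹` there. -/
def PressureEquation (Φ P : ℝ → ℝ) (a b : ℝ) : Prop :=
  ContDiffOn ℝ 1 P (Ioo a b) ∧ ∀ ψ : ℝ → ℝ, IsTestFunction a b ψ →
    ∫ x in Ioo a b, deriv P x * deriv ψ x = -∫ x in Ioo a b, deriv Φ x * deriv ψ x

/-- The velocity law `V = ν (-∂ₓP - ∂ₓΦ)` at time `t` at both endpoints of the patch
`(a t, b t)`, the `x`-derivatives being taken from inside the patch. -/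
def VelocityLaw (Φ P : ℝ → ℝ) (a b : ℝ → ℝ) (t : ℝ) : Prop :=
  (∃ V, HasDerivAt a V t ∧
    Tendsto (fun x => -deriv P x - deriv Φ x) (𝓝[>] (a t)) (𝓝 V)) ∧
  (∃ V, HasDerivAt b V t ∧
    Tendsto (fun x => -deriv P x - deriv Φ x) (𝓝[<] (b t)) (𝓝 V))

/-- Two-phase Hele-Shaw flow with drifts `-∂ₓΦ₁, -∂ₓΦ₂` for the phases `(a₁ t, b₁ t)` and
`(a₂ t, b₂ t)` (the second phase being on the left) and the pressure `p`: the interfaces move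
absolutely continuously and, for almost every time, `p t` has a nonnegative continuous
representative `P` on the closure of `Ω = (α, β)` that
vanishes in `Ω` outside the phases and on their one-phase boundary, solves the pressure equation in
each phase, drives the interfaces by the velocity law, and has matching fluxes wherever
the two phases are in contact. -/
structure IsHeleShawFlow (T α β : ℝ) (Φ₁ Φ₂ : ℝ → ℝ) (a₁ b₁ a₂ b₂ : ℝ → ℝ)
    (p : ℝ → ℝ → ℝ) : Prop where
  ordered : ∀ t ∈ Icc 0 T, b₂ t ≤ a₁ t
  ac_one : AbsolutelyContinuousOnInterval a₁ 0 T ∧ AbsolutelyContinuousOnInterval b₁ 0 T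
  ac_two : AbsolutelyContinuousOnInterval a₂ 0 T ∧ AbsolutelyContinuousOnInterval b₂ 0 T
  laws : ∀ᵐ t ∂(volume.restrict (Ioo 0 T)), ∃ P : ℝ → ℝ,
    ContinuousOn P (Icc α β) ∧
    p t =ᵐ[volume.restrict (Ioo α β)] P ∧
    (∀ x ∈ Icc α β, 0 ≤ P x) ∧
    (∀ x ∈ Ioo α β, x ∉ Ioo (a₁ t) (b₁ t) → x ∉ Ioo (a₂ t) (b₂ t) →
      ¬(x = b₂ t ∧ x = a₁ t) → P x = 0) ∧
    PressureEquation Φ₁ P (a₁ t) (b₁ t) ∧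
    PressureEquation Φ₂ P (a₂ t) (b₂ t) ∧
    VelocityLaw Φ₁ P a₁ b₁ t ∧
    VelocityLaw Φ₂ P a₂ b₂ t ∧
    (b₂ t = a₁ t → ∃ q : ℝ,
      Tendsto (fun x => deriv P x + deriv Φ₁ x) (𝓝[>] (a₁ t)) (𝓝 q) ∧
      Tendsto (fun x => deriv P x + deriv Φ₂ x) (𝓝[<] (b₂ t)) (𝓝 q))

end CrossDiffusion

end

noncomputable section

namespace CrossDiffusion

/-! Three monotone quantities drive the proof. Write each equation as `∂ₜρ = ∂ₓK` with `K = (∂ₓp +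
Φ')ρ`, and let `Fᵢ` be the distribution function of `ρᵢ`.

Order. The functional `∫ F₂ ρ₁` has time derivative `∫ (K₂ρ₁ - K₁ρ₂)`. The pressure cancels and `∫
(Φ₂' - Φ₁')ρ₁ρ₂ ≥ 0` remains. Initially the functional equals `M₁M₂`, its largest possible value, so
it keeps this value, and at every time a point `z` has all of species 2 on its left and all of
species 1 on its right (`IsFlow.overlap_mono`, `exists_separating_point`).

Saturation. The second difference in space of the double primitive of `ρ` is at most `δ²`, with
equality where `ρ = 1`. A time of saturation is thus a maximum, and the time derivative vanishes
there. This says that the flux has equal integrals over adjacent intervals of equal length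
(`IsFlow.ae_flux_balanced`), that is, `p + Φ` satisfies the midpoint identity and is affine on
saturated intervals.

Rigidity. On the side of `z` that belongs to one species, `p + Φ` is convex: where `p > 0` the
density is saturated and `p + Φ` is affine nearby, and where `p = 0` it touches the convex function
`Φ` from above (`convexOn_of_touching_or_midpoint`). The velocity `-(p + Φ)'` therefore contracts
the species towards its barycenter, and its variance does not increase. Among densities bounded by 1
of mass `M`, the variance is smallest exactly for indicators of intervals of length `M`. The initial
datum is such an indicator, so the density remains one, centered at its barycenter
(`eq_indicator_of_second_moment_le`, `IsFlow.eq_patch`).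

Each patch thus moves rigidly. If `w` is the slope of `p + Φ` in it, the barycenter has velocity
`-w`, which gives the velocity law at both endpoints. When the patches touch, the gap between them
is minimal, so its derivative vanishes and the two slopes agree. -/

/-- The product rule for primitives of integrable functions. -/
theorem integral_mul_primitive_add {f g : ℝ → ℝ} {a b : ℝ}
    (hf : IntervalIntegrable f volume a b) (hg : IntervalIntegrable g volume a b) :
    (∫ x in a..b, f x * ∫ y in a..x, g y) + ∫ x in a..b, (∫ y in a..x, f y) * g x =
      (∫ x in a..b, f x) * ∫ x in a..b, g x := by
  have hF := hf.absolutelyContinuousOnInterval_intervalIntegral (c := a) left_mem_uIcc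
  have hG := hg.absolutelyContinuousOnInterval_intervalIntegral (c := a) left_mem_uIcc
  have h := hF.integral_deriv_mul_eq_sub hG
  rw [← intervalIntegral.integral_add (hf.mul_continuousOn hG.continuousOn)
    (hg.continuousOn_mul hF.continuousOn)]
  simp only [intervalIntegral.integral_same, mul_zero, sub_zero] at h
  rw [← h]
  apply intervalIntegral.integral_congr_ae
  filter_upwards [hf.ae_hasDerivAt_integral, hg.ae_hasDerivAt_integral] with x h1 h2 hx
  have hx' := uIoc_subset_uIcc hx
  rw [(h1 hx' a left_mem_uIcc).deriv, (h2 hx' a left_mem_uIcc).deriv]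

/-- A density `ρ` on `[0,T] × (α, β)` of mass `M`, bounded by `1`, that is driven by the flux
`-K`, i.e. `∂ₜρ = ∂ₓK` with no flux through the boundary. -/
structure IsFlow (T α β M : ℝ) (ρ K : ℝ → ℝ → ℝ) : Prop where
  lt : α < β
  integrable : ∀ t ∈ Icc 0 T, IntervalIntegrable (ρ t) volume α β
  nonneg : ∀ t ∈ Icc 0 T, ∀ᵐ x ∂volume.restrict (Ioc α β), 0 ≤ ρ t x
  mass : ∀ t ∈ Icc 0 T, ∫ x in α..β, ρ t x = M
  ae_le_one : ∀ᵐ t ∂volume.restrict (Ioc 0 T), ∀ᵐ x ∂volume.restrict (Ioc α β), ρ t x ≤ 1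
  flux : IntegrableOn (Function.uncurry K) (Ioc 0 T ×ˢ Ioc α β)
  weak : ∀ ψ : ℝ → ℝ, ContDiff ℝ 1 ψ → ∀ s t : ℝ, 0 ≤ s → s ≤ t → t ≤ T →
    ∫ τ in s..t, ∫ x in α..β, K τ x * deriv ψ x =
      (∫ x in α..β, ρ s x * ψ x) - ∫ x in α..β, ρ t x * ψ x

/-! ### Fubini for the flux -/

section Slices

variable {T α β : ℝ} {K : ℝ → ℝ → ℝ}

theorem integrable_flux_restrict (hK : IntegrableOn (Function.uncurry K) (Ioc 0 T ×ˢ Ioc α β))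
    {s t u v : ℝ} (hs : 0 ≤ s) (ht : t ≤ T) (hu : α ≤ u) (hv : v ≤ β) :
    Integrable (Function.uncurry K)
      ((volume.restrict (Ioc s t)).prod (volume.restrict (Ioc u v))) := by
  rw [Measure.prod_restrict]
  exact IntegrableOn.mono_set hK (prod_mono (Ioc_subset_Ioc hs ht) (Ioc_subset_Ioc hu hv))

theorem integrable_flux_mul (hK : IntegrableOn (Function.uncurry K) (Ioc 0 T ×ˢ Ioc α β))
    {s t u v : ℝ} (hs : 0 ≤ s) (ht : t ≤ T) (hu : α ≤ u) (hv : v ≤ β) {g : ℝ → ℝ} {C : ℝ}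
    (hg : AEStronglyMeasurable g (volume.restrict (Ioc u v)))
    (hC : ∀ᵐ x ∂volume.restrict (Ioc u v), ‖g x‖ ≤ C) :
    Integrable (Function.uncurry fun τ x => K τ x * g x)
      ((volume.restrict (Ioc s t)).prod (volume.restrict (Ioc u v))) := by
  refine (integrable_flux_restrict hK hs ht hu hv).mul_bdd (c := C) hg.comp_snd ?_
  exact Measure.quasiMeasurePreserving_snd.ae hC

theorem intervalIntegrable_integral_flux_mul
    (hK : IntegrableOn (Function.uncurry K) (Ioc 0 T ×ˢ Ioc α β))
    {s t u v : ℝ} (hs : 0 ≤ s) (hst : s ≤ t) (ht : t ≤ T) (hu : α ≤ u) (huv : u ≤ v) (hv : v ≤ β)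
    {g : ℝ → ℝ} {C : ℝ} (hg : AEStronglyMeasurable g (volume.restrict (Ioc u v)))
    (hC : ∀ᵐ x ∂volume.restrict (Ioc u v), ‖g x‖ ≤ C) :
    IntervalIntegrable (fun τ => ∫ x in u..v, K τ x * g x) volume s t := by
  rw [intervalIntegrable_iff_integrableOn_Ioc_of_le hst]
  simp_rw [intervalIntegral.integral_of_le huv]
  exact (integrable_flux_mul hK hs ht hu hv hg hC).integral_prod_left

theorem integral_flux_swap
    (hK : IntegrableOn (Function.uncurry K) (Ioc 0 T ×ˢ Ioc α β))
    {s t u v : ℝ} (hs : 0 ≤ s) (hst : s ≤ t) (ht : t ≤ T) (hu : α ≤ u) (huv : u ≤ v) (hv : v ≤ β)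
    {g : ℝ → ℝ} {C : ℝ} (hg : AEStronglyMeasurable g (volume.restrict (Ioc u v)))
    (hC : ∀ᵐ x ∂volume.restrict (Ioc u v), ‖g x‖ ≤ C) :
    ∫ τ in s..t, ∫ x in u..v, K τ x * g x = ∫ x in u..v, (∫ τ in s..t, K τ x) * g x := by
  simp_rw [intervalIntegral.integral_of_le hst, intervalIntegral.integral_of_le huv]
  rw [integral_integral_swap (integrable_flux_mul hK hs ht hu hv hg hC)]
  simp_rw [integral_mul_const]

theorem intervalIntegrable_time_integral_flux
    (hK : IntegrableOn (Function.uncurry K) (Ioc 0 T ×ˢ Ioc α β))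
    {s t u v : ℝ} (hs : 0 ≤ s) (hst : s ≤ t) (ht : t ≤ T) (hu : α ≤ u) (huv : u ≤ v) (hv : v ≤ β) :
    IntervalIntegrable (fun x => ∫ τ in s..t, K τ x) volume u v := by
  rw [intervalIntegrable_iff_integrableOn_Ioc_of_le huv]
  simp_rw [intervalIntegral.integral_of_le hst]
  exact (integrable_flux_restrict hK hs ht hu hv).integral_prod_right

theorem ae_integrable_flux_slice
    (hK : IntegrableOn (Function.uncurry K) (Ioc 0 T ×ˢ Ioc α β)) (hαβ : α ≤ β) :
    ∀ᵐ τ ∂volume.restrict (Ioc 0 T), IntervalIntegrable (K τ) volume α β := by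
  filter_upwards [(integrable_flux_restrict hK le_rfl le_rfl le_rfl le_rfl).prod_right_ae]
    with τ h
  exact (intervalIntegrable_iff_integrableOn_Ioc_of_le hαβ).2 h

end Slices

/-! ### The equation for the distribution function -/

section Cdf

variable {T α β M : ℝ} {ρ K : ℝ → ℝ → ℝ}

/-- This is the equation integrated once in space. The test function is the primitive of an
arbitrary bump `g`. It need not vanish at `β`, so the no-flux condition enters here. -/
theorem IsFlow.cdf_sub (h : IsFlow T α β M ρ K) {s t : ℝ} (hs : 0 ≤ s) (hst : s ≤ t)
    (ht : t ≤ T) :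
    ∀ᵐ x ∂volume.restrict (Ioc α β),
      (∫ y in α..x, ρ t y) - (∫ y in α..x, ρ s y) = ∫ τ in s..t, K τ x := by
  have hαβ := h.lt.le
  have hit := h.integrable t ⟨hs.trans hst, ht⟩
  have his := h.integrable s ⟨hs, hst.trans ht⟩
  have hFt := (hit.absolutelyContinuousOnInterval_intervalIntegral (c := α) left_mem_uIcc)
  have hFs := (his.absolutelyContinuousOnInterval_intervalIntegral (c := α) left_mem_uIcc)
  have hk := intervalIntegrable_time_integral_flux h.flux hs hst ht le_rfl hαβ le_rfl
  set f : ℝ → ℝ := fun x =>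
    ((∫ y in α..x, ρ t y) - ∫ y in α..x, ρ s y) - ∫ τ in s..t, K τ x with hf
  have hfi : IntervalIntegrable f volume α β :=
    (hFt.continuousOn.intervalIntegrable.sub hFs.continuousOn.intervalIntegrable).sub hk
  have hloc : LocallyIntegrableOn f (Ioo α β) volume :=
    (((intervalIntegrable_iff_integrableOn_Ioc_of_le hαβ).1 hfi).mono_set
      Ioo_subset_Ioc_self).locallyIntegrableOn
  have key := isOpen_Ioo.ae_eq_zero_of_integral_contDiff_smul_eq_zero hloc (fun g hg _ hsupp => by
    have hgc : Continuous g := hg.continuous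
    set ψ : ℝ → ℝ := fun x => ∫ y in α..x, g y with hψ
    have hd : ∀ x, HasDerivAt ψ (g x) x := fun x =>
      intervalIntegral.integral_hasDerivAt_right (hgc.intervalIntegrable _ _)
        (hgc.stronglyMeasurableAtFilter _ _) hgc.continuousAt
    have hdψ : deriv ψ = g := funext fun x => (hd x).deriv
    have hψ1 : ContDiff ℝ 1 ψ := contDiff_one_iff_deriv.2
      ⟨fun x => (hd x).differentiableAt, hdψ ▸ hgc⟩
    have hw := h.weak ψ hψ1 s t hs hst ht
    obtain ⟨C, hC⟩ := (isCompact_Icc (a := α) (b := β)).exists_bound_of_continuousOn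
      hgc.continuousOn
    rw [hdψ, integral_flux_swap (C := C) h.flux hs hst ht le_rfl hαβ le_rfl
      hgc.aestronglyMeasurable ((ae_restrict_mem measurableSet_Ioc).mono
        fun x hx => hC x (Ioc_subset_Icc_self hx))] at hw
    have p1 := integral_mul_primitive_add hit (hgc.intervalIntegrable α β)
    have p2 := integral_mul_primitive_add his (hgc.intervalIntegrable α β)
    -- The boundary terms of the two integrations by parts are both `M * ∫ g` and cancel.
    rw [h.mass t ⟨hs.trans hst, ht⟩] at p1
    rw [h.mass s ⟨hs, hst.trans ht⟩] at p2
    have e1 : ∫ x, g x • f x = ∫ x in α..β, g x • f x := by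
      refine (intervalIntegral.integral_eq_integral_of_support_subset ?_).symm
      intro x hx
      refine Ioo_subset_Ioc_self (hsupp (subset_tsupport g ?_))
      intro h0
      simp [h0] at hx
    have i1 := (hFt.continuousOn.intervalIntegrable (μ := volume)).mul_continuousOn (hgc.continuousOn (s := uIcc α β))
    have i2 := (hFs.continuousOn.intervalIntegrable (μ := volume)).mul_continuousOn (hgc.continuousOn (s := uIcc α β))
    have i3 := hk.mul_continuousOn (hgc.continuousOn (s := uIcc α β))
    have e2 : ∫ x in α..β, g x • f x = ((∫ x in α..β, (∫ y in α..x, ρ t y) * g x) -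
        ∫ x in α..β, (∫ y in α..x, ρ s y) * g x) - ∫ x in α..β, (∫ τ in s..t, K τ x) * g x := by
      rw [← intervalIntegral.integral_sub i1 i2, ← intervalIntegral.integral_sub (i1.sub i2) i3]
      refine intervalIntegral.integral_congr fun x _ => ?_
      simp only [hf, smul_eq_mul]
      ring
    rw [e1, e2]
    linarith)
  rw [← restrict_Ioo_eq_restrict_Ioc, ae_restrict_iff' measurableSet_Ioo]
  filter_upwards [key] with x hx hx'
  have := hx hx'
  simp only [hf] at this
  linarith

end Cdf

/-! ### The density bound at every time, weak continuity, and flux balance -/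

section Bounds

variable {T α β M : ℝ} {ρ K : ℝ → ℝ → ℝ}

theorem IsFlow.intervalIntegrable_moment (h : IsFlow T α β M ρ K) (hT : 0 ≤ T) {ψ : ℝ → ℝ}
    (hψ : ContDiff ℝ 1 ψ) :
    IntervalIntegrable (fun τ => ∫ x in α..β, K τ x * deriv ψ x) volume 0 T := by
  have hc : Continuous (deriv ψ) := hψ.continuous_deriv le_rfl
  obtain ⟨C, hC⟩ := (isCompact_Icc (a := α) (b := β)).exists_bound_of_continuousOn hc.continuousOn
  exact intervalIntegrable_integral_flux_mul (C := C) h.flux le_rfl hT le_rfl le_rfl h.lt.le le_rfl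
    hc.aestronglyMeasurable
    ((ae_restrict_mem measurableSet_Ioc).mono fun x hx => hC x (Ioc_subset_Icc_self hx))

theorem IsFlow.moment_eq (h : IsFlow T α β M ρ K) {ψ : ℝ → ℝ} (hψ : ContDiff ℝ 1 ψ) {t : ℝ}
    (ht : t ∈ Icc 0 T) :
    ∫ x in α..β, ρ t x * ψ x =
      (∫ x in α..β, ρ 0 x * ψ x) - ∫ τ in 0..t, ∫ x in α..β, K τ x * deriv ψ x := by
  linarith [h.weak ψ hψ 0 t le_rfl ht.1 ht.2]

theorem IsFlow.continuousOn_moment (h : IsFlow T α β M ρ K) (hT : 0 ≤ T) {ψ : ℝ → ℝ}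
    (hψ : ContDiff ℝ 1 ψ) :
    ContinuousOn (fun t => ∫ x in α..β, ρ t x * ψ x) (Icc 0 T) := by
  have h1 := ((h.intervalIntegrable_moment hT
    hψ).absolutelyContinuousOnInterval_intervalIntegral (c := 0) left_mem_uIcc).continuousOn
  rw [uIcc_of_le hT] at h1
  exact (continuousOn_const.sub h1).congr fun t ht => h.moment_eq hψ ht

theorem le_on_Icc_of_ae_le {f : ℝ → ℝ} {a b c : ℝ} (hab : a < b) (hf : ContinuousOn f (Icc a b))
    (h : ∀ᵐ t ∂volume.restrict (Ioc a b), f t ≤ c) {t : ℝ} (ht : t ∈ Icc a b) : f t ≤ c := by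
  -- Taking the maximum with `c` turns the inequality into an a.e. equality of continuous functions,
  -- which then holds everywhere.
  have h1 : (fun t => max (f t) c) =ᵐ[volume.restrict (Icc a b)] fun _ => c := by
    rw [← restrict_Ioc_eq_restrict_Icc]
    filter_upwards [h] with s hs using max_eq_right hs
  have h2 := Measure.eqOn_Icc_of_ae_eq volume hab.ne h1 (hf.sup continuousOn_const)
    continuousOn_const ht
  exact max_eq_right_iff.1 h2

theorem integral_le_sub_of_le_one {f : ℝ → ℝ} {a b u v : ℝ} (hf : IntervalIntegrable f volume a b)
    (h1 : ∀ᵐ x ∂volume.restrict (Ioc a b), f x ≤ 1) (hau : a ≤ u) (huv : u ≤ v) (hvb : v ≤ b) :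
    ∫ x in u..v, f x ≤ v - u := by
  have hfi : IntervalIntegrable f volume u v := hf.mono_set (by
    rw [uIcc_of_le huv, uIcc_of_le (hau.trans (huv.trans hvb))]; exact Icc_subset_Icc hau hvb)
  have := intervalIntegral.integral_mono_ae_restrict huv hfi
    (intervalIntegrable_const (c := (1 : ℝ))) (by
      rw [← restrict_Ioc_eq_restrict_Icc]
      exact ae_restrict_of_ae_restrict_of_subset (Ioc_subset_Ioc hau hvb) h1)
  simpa using this

theorem le_one_of_integral_le_sub {f : ℝ → ℝ} {a b : ℝ} (hab : a ≤ b)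
    (hf : IntervalIntegrable f volume a b)
    (h : ∀ u v, a < u → u < v → v < b → ∫ x in u..v, f x ≤ v - u) :
    ∀ᵐ x ∂volume.restrict (Ioc a b), f x ≤ 1 := by
  rw [← restrict_Ioo_eq_restrict_Ioc, ae_restrict_iff' measurableSet_Ioo]
  filter_upwards [hf.ae_hasDerivAt_integral] with x hx hxm
  have hxm' : x ∈ uIcc a b := by rw [uIcc_of_le hab]; exact Ioo_subset_Icc_self hxm
  have hd := hx hxm' x hxm'
  have hs := (hasDerivAt_iff_tendsto_slope.1 hd).mono_left
    (nhdsWithin_mono x (show Ioi x ⊆ {x}ᶜ from fun y (hy : x < y) => hy.ne'))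
  refine le_of_tendsto hs ?_
  filter_upwards [Ioo_mem_nhdsGT hxm.2] with y hy
  rw [slope_def_field, intervalIntegral.integral_same, sub_zero, div_le_one (sub_pos.2 hy.1)]
  exact h x y hxm.1 hy.1 hy.2

/-- The bound is given for almost every time only, but moments against `C¹` functions are continuous
in time. Testing with a bump slightly wider than `(u, v)` therefore bounds the mass of `(u, v)` at
all times. -/
theorem IsFlow.le_one (h : IsFlow T α β M ρ K) (hT : 0 < T) {t : ℝ} (ht : t ∈ Icc 0 T) :
    ∀ᵐ x ∂volume.restrict (Ioc α β), ρ t x ≤ 1 := by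
  have hαβ := h.lt.le
  have hit := h.integrable t ht
  refine le_one_of_integral_le_sub hαβ hit fun u v hu huv hv => ?_
  refine le_of_forall_pos_le_add fun ε hε => ?_
  -- Equal to 1 on `[u, v]` and supported in `[u - ε/2, v + ε/2]`, whose length is `v - u + ε`.
  set f : ContDiffBump ((u + v) / 2) :=
    ⟨(v - u) / 2, (v - u + ε) / 2, by linarith, by linarith⟩ with hfdef
  have hfc : ContDiff ℝ 1 f := f.contDiff
  have hfi : ∀ s ∈ Icc 0 T, IntervalIntegrable (fun x => ρ s x * f x) volume α β := fun s hs =>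
    (h.integrable s hs).mul_continuousOn hfc.continuous.continuousOn
  have hle : ∫ x in α..β, f x ≤ v - u + ε := by
    have h1 : ∫ x in α..β, f x ≤ ∫ x in α..β,
        (Icc (u - ε / 2) (v + ε / 2)).indicator (fun _ => (1 : ℝ)) x := by
      refine intervalIntegral.integral_mono_on hαβ (hfc.continuous.intervalIntegrable _ _) ?_
        fun x _ => ?_
      · exact (intervalIntegrable_iff.2 ((integrableOn_const (by simp)).indicator
          measurableSet_Icc))
      · by_cases hx : x ∈ Icc (u - ε / 2) (v + ε / 2)
        · rw [indicator_of_mem hx]; exact f.le_one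
        · rw [indicator_of_notMem hx]
          refine (f.zero_of_le_dist ?_).le
          rw [Real.dist_eq]
          simp only [hfdef]
          by_contra hlt
          rw [not_le, abs_lt] at hlt
          exact hx ⟨by linarith [hlt.1], by linarith [hlt.2]⟩
    refine h1.trans ?_
    rw [intervalIntegral.integral_of_le hαβ, integral_indicator measurableSet_Icc,
      setIntegral_const, smul_eq_mul, mul_one, measureReal_restrict_apply measurableSet_Icc]
    refine (measureReal_mono inter_subset_left (by simp)).trans ?_
    rw [Real.volume_real_Icc_of_le (by linarith)]
    linarith
  have hall := le_on_Icc_of_ae_le (c := v - u + ε) hT (h.continuousOn_moment hT.le hfc) (by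
    filter_upwards [h.ae_le_one, ae_restrict_mem measurableSet_Ioc] with s hs hsm
    refine le_trans ?_ hle
    refine intervalIntegral.integral_mono_ae_restrict hαβ (hfi s (Ioc_subset_Icc_self hsm))
      (hfc.continuous.intervalIntegrable _ _) ?_
    rw [← restrict_Ioc_eq_restrict_Icc]
    filter_upwards [hs] with x hx
    nlinarith [f.nonneg (x := x)]) ht
  refine le_trans ?_ hall
  have e : ∫ x in u..v, ρ t x = ∫ x in u..v, ρ t x * f x := by
    refine intervalIntegral.integral_congr fun x hx => ?_
    rw [uIcc_of_le huv.le] at hx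
    have : f x = 1 := f.one_of_mem_closedBall (by
      rw [Metric.mem_closedBall, Real.dist_eq, abs_le]
      simp only [hfdef]
      constructor <;> linarith [hx.1, hx.2])
    simp [this]
  rw [e, intervalIntegral.integral_of_le huv.le, intervalIntegral.integral_of_le hαβ]
  refine setIntegral_mono_set ((intervalIntegrable_iff_integrableOn_Ioc_of_le hαβ).1 (hfi t ht)) ?_
    (Ioc_subset_Ioc hu.le hv.le).eventuallyLE
  filter_upwards [h.nonneg t ht] with x hx using mul_nonneg hx f.nonneg

/-- Since `0 ≤ ρ ≤ 1`, an `L¹` approximation of `g` changes the integral by a small amount uniformly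
in time. This reduces the claim to polynomials, which are admissible test functions. The merely
integrable `g` needed later are time slices of the flux. -/
theorem IsFlow.continuousOn_integral_mul (h : IsFlow T α β M ρ K) (hT : 0 < T) {g : ℝ → ℝ}
    (hg : IntervalIntegrable g volume α β) :
    ContinuousOn (fun t => ∫ x in α..β, ρ t x * g x) (Icc 0 T) := by
  have hαβ := h.lt.le
  have hbd : ∀ t ∈ Icc 0 T, ∀ᵐ x ∂volume.restrict (Ioc α β), ‖ρ t x‖ ≤ 1 := fun t ht => by
    filter_upwards [h.nonneg t ht, h.le_one hT ht] with x h0 h1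
    rw [Real.norm_eq_abs, abs_of_nonneg h0]; exact h1
  have hmul : ∀ t ∈ Icc 0 T, ∀ f : ℝ → ℝ, IntervalIntegrable f volume α β →
      IntervalIntegrable (fun x => ρ t x * f x) volume α β := fun t ht f hf => by
    rw [intervalIntegrable_iff_integrableOn_Ioc_of_le hαβ] at hf ⊢
    exact hf.bdd_mul ((h.integrable t ht).1.aestronglyMeasurable) (hbd t ht)
  refine continuousOn_of_uniform_approx_of_continuousOn fun U hU => ?_
  obtain ⟨ε, hε, hεU⟩ := Metric.mem_uniformity_dist.1 hU
  -- The total error is `η` in `L¹` plus `η` uniformly over length `β - α`, which adds up to `ε /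
  -- 2`.
  set η := ε / (2 * (1 + (β - α))) with hη
  have hpos : 0 < 1 + (β - α) := by linarith
  have hη0 : 0 < η := by positivity
  have hg' := (intervalIntegrable_iff_integrableOn_Ioc_of_le hαβ).1 hg
  obtain ⟨g₁, -, hg₁, hg₁c, hg₁i⟩ := Integrable.exists_hasCompactSupport_integral_sub_le hg' hη0
  obtain ⟨q, hq⟩ := exists_polynomial_near_of_continuousOn α β g₁ hg₁c.continuousOn η hη0
  have hqc : ContDiff ℝ 1 fun x => q.eval x := by
    simpa using q.contDiff_aeval (𝕜 := ℝ) 1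
  refine ⟨_, h.continuousOn_moment hT.le hqc, fun t ht => hεU ?_⟩
  have hqi : IntervalIntegrable (fun x => q.eval x) volume α β :=
    hqc.continuous.intervalIntegrable _ _
  have hg₁i' : IntervalIntegrable g₁ volume α β := hg₁c.intervalIntegrable _ _
  rw [dist_eq_norm, ← intervalIntegral.integral_sub (hmul t ht _ hg) (hmul t ht _ hqi)]
  have b1 : ‖∫ x in α..β, (ρ t x * g x - ρ t x * q.eval x)‖ ≤
      ∫ x in α..β, (‖g x - g₁ x‖ + η) := by
    refine (intervalIntegral.norm_integral_le_integral_norm hαβ).trans ?_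
    refine intervalIntegral.integral_mono_ae_restrict hαβ
      ((hmul t ht _ hg).sub (hmul t ht _ hqi)).norm
      ((hg.sub hg₁i').norm.add intervalIntegrable_const) ?_
    rw [← restrict_Ioc_eq_restrict_Icc]
    filter_upwards [hbd t ht, ae_restrict_mem measurableSet_Ioc] with x hx hxm
    have hx2 := hq x (Ioc_subset_Icc_self hxm)
    rw [← mul_sub, norm_mul]
    calc ‖ρ t x‖ * ‖g x - q.eval x‖ ≤ 1 * ‖g x - q.eval x‖ := by gcongr
      _ = ‖(g x - g₁ x) + (g₁ x - q.eval x)‖ := by rw [one_mul]; congr 1; ring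
      _ ≤ ‖g x - g₁ x‖ + ‖g₁ x - q.eval x‖ := norm_add_le _ _
      _ ≤ ‖g x - g₁ x‖ + η := by
        gcongr
        rw [norm_sub_rev]
        exact hx2.le
  refine b1.trans_lt ?_
  rw [intervalIntegral.integral_add (hg.sub hg₁i').norm intervalIntegrable_const,
    intervalIntegral.integral_const, smul_eq_mul, intervalIntegral.integral_of_le hαβ]
  have : η * (1 + (β - α)) = ε / 2 := by rw [hη]; field_simp
  nlinarith

/-- A second integration in space removes the exceptional set of points: for each fixed `x` the
double primitive is absolutely continuous in time. -/
theorem IsFlow.integral_cdf_sub (h : IsFlow T α β M ρ K) {s t x : ℝ} (hs : 0 ≤ s) (hst : s ≤ t)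
    (ht : t ≤ T) (hx : x ∈ Icc α β) :
    (∫ y in α..x, ∫ z in α..y, ρ t z) - (∫ y in α..x, ∫ z in α..y, ρ s z) =
      ∫ τ in s..t, ∫ y in α..x, K τ y := by
  have hsub : uIcc α x ⊆ uIcc α β := by
    rw [uIcc_of_le hx.1, uIcc_of_le h.lt.le]; exact Icc_subset_Icc_right hx.2
  have hF : ∀ r ∈ Icc 0 T, IntervalIntegrable (fun y => ∫ z in α..y, ρ r z) volume α x :=
    fun r hr => (((h.integrable r hr).absolutelyContinuousOnInterval_intervalIntegral (c := α)
      left_mem_uIcc).continuousOn.mono hsub).intervalIntegrable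
  rw [← intervalIntegral.integral_sub (hF t ⟨hs.trans hst, ht⟩) (hF s ⟨hs, hst.trans ht⟩)]
  have := integral_flux_swap (g := fun _ => 1) (C := 1) h.flux hs hst ht le_rfl hx.1 hx.2
    aestronglyMeasurable_const (by simp)
  simp only [mul_one] at this
  rw [this]
  refine intervalIntegral.integral_congr_ae ?_
  rw [uIoc_of_le hx.1]
  have hc := ae_restrict_of_ae_restrict_of_subset (Ioc_subset_Ioc_right hx.2)
    (h.cdf_sub hs hst ht)
  exact (ae_restrict_iff' measurableSet_Ioc).1 hc

/-- The second difference of `∫ F`, where `F` is the distribution function of `ρ`, is at most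
`δ²`, and it equals `δ²` where `ρ = 1`. -/
theorem second_difference_integral_cdf {f : ℝ → ℝ} {a b c δ : ℝ}
    (hf : IntervalIntegrable f volume a b) (h1 : ∀ᵐ x ∂volume.restrict (Ioc a b), f x ≤ 1)
    (hδ : 0 < δ) (ha : a ≤ c - δ) (hb : c + δ ≤ b) :
    ((∫ y in a..(c + δ), ∫ z in a..y, f z) - 2 * (∫ y in a..c, ∫ z in a..y, f z) +
      (∫ y in a..(c - δ), ∫ z in a..y, f z) ≤ δ ^ 2) ∧
    ((∀ᵐ x ∂volume.restrict (Ioc (c - δ) (c + δ)), f x = 1) →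
      (∫ y in a..(c + δ), ∫ z in a..y, f z) - 2 * (∫ y in a..c, ∫ z in a..y, f z) +
        (∫ y in a..(c - δ), ∫ z in a..y, f z) = δ ^ 2) := by
  have hab : a ≤ b := by linarith
  have hFc := (hf.absolutelyContinuousOnInterval_intervalIntegral (c := a)
      left_mem_uIcc).continuousOn
  rw [uIcc_of_le hab] at hFc
  have hfi : ∀ u v, a ≤ u → u ≤ v → v ≤ b → IntervalIntegrable f volume u v := fun u v h1 h2 h3 =>
    hf.mono_set (by rw [uIcc_of_le h2, uIcc_of_le hab]; exact Icc_subset_Icc h1 h3)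
  have hFi : ∀ u v, a ≤ u → u ≤ v → v ≤ b →
      IntervalIntegrable (fun y => ∫ z in a..y, f z) volume u v := fun u v h1 h2 h3 =>
    (hFc.mono (by rw [uIcc_of_le h2]; exact Icc_subset_Icc h1 h3)).intervalIntegrable
  -- The second difference is the integral over `y` of the mass in the window `(y, y + δ)`, which is
  -- at most `δ`, and exactly `δ` where `f = 1`.
  have e0 : (∫ y in a..(c + δ), ∫ z in a..y, f z) - 2 * (∫ y in a..c, ∫ z in a..y, f z) +
      (∫ y in a..(c - δ), ∫ z in a..y, f z) =
      ∫ y in (c - δ)..c, ∫ z in y..(y + δ), f z := by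
    have i1 := intervalIntegral.integral_add_adjacent_intervals
      (hFi a c le_rfl (by linarith) (by linarith)) (hFi c (c + δ) (by linarith) (by linarith) hb)
    have i2 := intervalIntegral.integral_add_adjacent_intervals
      (hFi a (c - δ) le_rfl ha (by linarith)) (hFi (c - δ) c ha (by linarith) (by linarith))
    have i3 : ∫ y in c..(c + δ), ∫ z in a..y, f z = ∫ y in (c - δ)..c, ∫ z in a..(y + δ), f z := by
      rw [intervalIntegral.integral_comp_add_right (fun y => ∫ z in a..y, f z) δ]
      simp
    have hshift : IntervalIntegrable (fun y => ∫ z in a..(y + δ), f z) volume (c - δ) c := by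
      have := (hFi c (c + δ) (by linarith) (by linarith) hb).comp_add_right δ
      simpa using this
    have i4 : (∫ y in (c - δ)..c, ∫ z in a..(y + δ), f z) - (∫ y in (c - δ)..c, ∫ z in a..y, f z) =
        ∫ y in (c - δ)..c, ∫ z in y..(y + δ), f z := by
      rw [← intervalIntegral.integral_sub hshift (hFi (c - δ) c ha (by linarith) (by linarith))]
      refine intervalIntegral.integral_congr fun y hy => ?_
      rw [uIcc_of_le (by linarith)] at hy
      exact intervalIntegral.integral_interval_sub_left
        (hfi a (y + δ) le_rfl (by linarith [hy.1]) (by linarith [hy.2]))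
        (hfi a y le_rfl (by linarith [hy.1]) (by linarith [hy.2]))
    linarith
  have hint : IntervalIntegrable (fun y => ∫ z in y..(y + δ), f z) volume (c - δ) c := by
    have hshift : IntervalIntegrable (fun y => ∫ z in a..(y + δ), f z) volume (c - δ) c := by
      have := (hFi c (c + δ) (by linarith) (by linarith) hb).comp_add_right δ
      simpa using this
    refine (hshift.sub (hFi (c - δ) c ha (by linarith) (by linarith))).congr_ae ?_
    refine (ae_restrict_mem measurableSet_uIoc).mono fun y hy => ?_
    rw [uIoc_of_le (by linarith)] at hy
    exact intervalIntegral.integral_interval_sub_left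
        (hfi a (y + δ) le_rfl (by linarith [hy.1]) (by linarith [hy.2]))
        (hfi a y le_rfl (by linarith [hy.1]) (by linarith [hy.2]))
  rw [e0]
  constructor
  · have := intervalIntegral.integral_mono_on (by linarith : c - δ ≤ c) hint
      (intervalIntegrable_const (c := δ)) (fun y hy => by
        have := integral_le_sub_of_le_one hf h1 (by linarith [hy.1] : a ≤ y)
          (by linarith : y ≤ y + δ) (by linarith [hy.2])
        linarith)
    rw [intervalIntegral.integral_const, smul_eq_mul] at this
    nlinarith
  · intro hone
    have : ∫ y in (c - δ)..c, ∫ z in y..(y + δ), f z = ∫ y in (c - δ)..c, δ := by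
      refine intervalIntegral.integral_congr fun y hy => ?_
      rw [uIcc_of_le (by linarith)] at hy
      have : ∫ z in y..(y + δ), f z = ∫ z in y..(y + δ), (1 : ℝ) := by
        refine intervalIntegral.integral_congr_ae ?_
        rw [uIoc_of_le (by linarith)]
        exact (ae_restrict_iff' measurableSet_Ioc).1
          (ae_restrict_of_ae_restrict_of_subset
            (Ioc_subset_Ioc (by linarith [hy.1]) (by linarith [hy.2])) hone)
      simp only [this, intervalIntegral.integral_const, smul_eq_mul]
      ring
    rw [this, intervalIntegral.integral_const, smul_eq_mul]
    ring

/-- Where the density is saturated, the flux is balanced. -/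
theorem IsFlow.ae_flux_balanced (h : IsFlow T α β M ρ K) (hT : 0 < T) :
    ∀ᵐ t ∂volume.restrict (Ioo 0 T), ∀ c δ : ℚ, (0 : ℝ) < δ → α ≤ c - δ → c + δ ≤ β →
      (∀ᵐ x ∂volume.restrict (Ioc (c - δ : ℝ) (c + δ)), ρ t x = 1) →
      ∫ x in (c - δ : ℝ)..c, K t x = ∫ x in (c : ℝ)..(c + δ), K t x := by
  simp only [ae_all_iff]
  -- The null set of times depends on `c` and `δ`; rational parameters keep the union countable.
  intro c δ hδ hc1 hc2
  have hder : ∀ x ∈ Icc α β, ∀ᵐ t ∂volume.restrict (Ioo 0 T),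
      HasDerivAt (fun s => ∫ y in α..x, ∫ z in α..y, ρ s z) (∫ y in α..x, K t y) t := by
    intro x hx
    have hint := intervalIntegrable_integral_flux_mul (g := fun _ => 1) (C := 1) h.flux le_rfl
      hT.le le_rfl le_rfl hx.1 hx.2 aestronglyMeasurable_const (by simp)
    simp only [mul_one] at hint
    rw [ae_restrict_iff' measurableSet_Ioo]
    filter_upwards [hint.ae_hasDerivAt_integral] with t ht htm
    rw [uIcc_of_le hT.le] at ht
    have hd := (ht (Ioo_subset_Icc_self htm) 0 ⟨le_rfl, hT.le⟩).const_add
      (∫ y in α..x, ∫ z in α..y, ρ 0 z)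
    refine hd.congr_of_eventuallyEq ?_
    filter_upwards [Ioo_mem_nhds htm.1 htm.2] with s hs
    rw [← h.integral_cdf_sub le_rfl hs.1.le hs.2.le hx]
    ring
  filter_upwards [hder (c - δ) ⟨hc1, by linarith⟩, hder c ⟨by linarith, by linarith⟩,
    hder (c + δ) ⟨by linarith, hc2⟩, ae_restrict_mem measurableSet_Ioo,
    ae_restrict_of_ae_restrict_of_subset Ioo_subset_Ioc_self
      (ae_integrable_flux_slice h.flux h.lt.le)] with t h1 h2 h3 htm hKi hone
  have hd := (h3.sub (h2.const_mul 2)).add h1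
  -- All times compete for the bound `δ²`, and saturation at time `t` attains it.
  have hmax : IsLocalMax (((fun s => ∫ y in α..(c + δ : ℝ), ∫ z in α..y, ρ s z) -
      (fun s => 2 * ∫ y in α..(c : ℝ), ∫ z in α..y, ρ s z)) +
      fun s => ∫ y in α..(c - δ : ℝ), ∫ z in α..y, ρ s z) t := by
    filter_upwards [Ioo_mem_nhds htm.1 htm.2] with s hs
    have e1 := (second_difference_integral_cdf (h.integrable s (Ioo_subset_Icc_self hs))
      (h.le_one hT (Ioo_subset_Icc_self hs)) hδ hc1 hc2).1
    have e2 := (second_difference_integral_cdf (h.integrable t (Ioo_subset_Icc_self htm))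
      (h.le_one hT (Ioo_subset_Icc_self htm)) hδ hc1 hc2).2 hone
    simp only [Pi.add_apply, Pi.sub_apply]
    linarith
  have h0 := hmax.hasDerivAt_eq_zero hd
  have hKi' : ∀ u v : ℝ, α ≤ u → u ≤ v → v ≤ β → IntervalIntegrable (K t) volume u v :=
    fun u v h1 h2 h3 => hKi.mono_set (by
      rw [uIcc_of_le h2, uIcc_of_le h.lt.le]; exact Icc_subset_Icc h1 h3)
  have j1 := intervalIntegral.integral_add_adjacent_intervals
    (hKi' α (c - δ) le_rfl hc1 (by linarith)) (hKi' (c - δ) c hc1 (by linarith) (by linarith))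
  have j2 := intervalIntegral.integral_add_adjacent_intervals
    (hKi' α c le_rfl (by linarith) (by linarith)) (hKi' c (c + δ) (by linarith) (by linarith) hc2)
  linarith

end Bounds

/-! ### Persistence of the order of the two species -/

section Ordering

variable {T α β M M₁ M₂ : ℝ} {ρ K ρ₁ ρ₂ K₁ K₂ : ℝ → ℝ → ℝ}

theorem IsFlow.norm_le_one (h : IsFlow T α β M ρ K) (hT : 0 < T) {t : ℝ} (ht : t ∈ Icc 0 T) :
    ∀ᵐ x ∂volume.restrict (Ioc α β), ‖ρ t x‖ ≤ 1 := by
  filter_upwards [h.nonneg t ht, h.le_one hT ht] with x h0 h1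
  rw [Real.norm_eq_abs, abs_of_nonneg h0]
  exact h1

/-- This is the discrete product rule `∫ (F₂(t) - F₂(s)) ρ₁(t) + ∫ F₂(s) (ρ₁(t) - ρ₁(s))`, with the
second term integrated by parts. Its boundary term vanishes because the mass is conserved. One
density is frozen at the final time and the other at the initial time. -/
theorem IsFlow.overlap_sub (h₁ : IsFlow T α β M₁ ρ₁ K₁) (h₂ : IsFlow T α β M₂ ρ₂ K₂) (hT : 0 < T)
    {s t : ℝ} (hs : 0 ≤ s) (hst : s ≤ t) (ht : t ≤ T) :
    (∫ x in α..β, (∫ y in α..x, ρ₂ t y) * ρ₁ t x) - (∫ x in α..β, (∫ y in α..x, ρ₂ s y) * ρ₁ s x) =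
      ∫ τ in s..t, ((∫ x in α..β, K₂ τ x * ρ₁ t x) - ∫ x in α..β, K₁ τ x * ρ₂ s x) := by
  have hαβ := h₁.lt.le
  have hsm : s ∈ Icc 0 T := ⟨hs, hst.trans ht⟩
  have htm : t ∈ Icc 0 T := ⟨hs.trans hst, ht⟩
  have m1 := (h₁.integrable t htm).1.aestronglyMeasurable
  have m2 := (h₂.integrable s hsm).1.aestronglyMeasurable
  have b1 := h₁.norm_le_one hT htm
  have b2 := h₂.norm_le_one hT hsm
  rw [intervalIntegral.integral_sub
    (intervalIntegrable_integral_flux_mul h₂.flux hs hst ht le_rfl hαβ le_rfl m1 b1)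
    (intervalIntegrable_integral_flux_mul h₁.flux hs hst ht le_rfl hαβ le_rfl m2 b2),
    integral_flux_swap h₂.flux hs hst ht le_rfl hαβ le_rfl m1 b1,
    integral_flux_swap h₁.flux hs hst ht le_rfl hαβ le_rfl m2 b2]
  have e1 : ∫ x in α..β, (∫ τ in s..t, K₂ τ x) * ρ₁ t x =
      ∫ x in α..β, ((∫ y in α..x, ρ₂ t y) - ∫ y in α..x, ρ₂ s y) * ρ₁ t x := by
    refine intervalIntegral.integral_congr_ae ((ae_restrict_iff' measurableSet_uIoc).1 ?_)
    rw [uIoc_of_le hαβ]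
    filter_upwards [h₂.cdf_sub hs hst ht] with x hx
    rw [hx]
  have e2 : ∫ x in α..β, (∫ τ in s..t, K₁ τ x) * ρ₂ s x =
      ∫ x in α..β, ((∫ y in α..x, ρ₁ t y) - ∫ y in α..x, ρ₁ s y) * ρ₂ s x := by
    refine intervalIntegral.integral_congr_ae ((ae_restrict_iff' measurableSet_uIoc).1 ?_)
    rw [uIoc_of_le hαβ]
    filter_upwards [h₁.cdf_sub hs hst ht] with x hx
    rw [hx]
  have hF : ∀ {f : ℝ → ℝ}, IntervalIntegrable f volume α β →
      ContinuousOn (fun x => ∫ y in α..x, f y) (uIcc α β) := fun hf =>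
    (hf.absolutelyContinuousOnInterval_intervalIntegral (c := α) left_mem_uIcc).continuousOn
  have i1t := h₁.integrable t htm
  have i1s := h₁.integrable s hsm
  have i2t := h₂.integrable t htm
  have i2s := h₂.integrable s hsm
  rw [e1, e2]
  simp_rw [sub_mul]
  rw [intervalIntegral.integral_sub (i1t.continuousOn_mul (hF i2t))
    (i1t.continuousOn_mul (hF i2s)), intervalIntegral.integral_sub (i2s.continuousOn_mul (hF i1t))
    (i2s.continuousOn_mul (hF i1s))]
  have p1 := integral_mul_primitive_add i2s i1t
  have p2 := integral_mul_primitive_add i2s i1s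
  rw [h₁.mass t htm, h₂.mass s hsm] at p1
  rw [h₁.mass s hsm, h₂.mass s hsm] at p2
  simp_rw [mul_comm (ρ₂ s _)] at p1 p2
  linarith

/-- The right endpoint of the cell containing `τ` in the partition of `(0, t]` into `n + 1` equal
cells; the left one is obtained by subtracting `t / (n + 1)`. -/
def gridPoint (t : ℝ) (n : ℕ) (τ : ℝ) : ℝ := ⌈τ * (n + 1) / t⌉₊ * (t / (n + 1))

theorem gridPoint_eq {t : ℝ} (ht : 0 < t) {n k : ℕ} {τ : ℝ}
    (h : τ ∈ Ioc (k * (t / (n + 1))) ((k + 1 : ℕ) * (t / (n + 1)))) :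
    gridPoint t n τ = (k + 1 : ℕ) * (t / (n + 1)) := by
  have hn : (0 : ℝ) < n + 1 := by positivity
  have : ⌈τ * (n + 1) / t⌉₊ = k + 1 := by
    rw [Nat.ceil_eq_iff (by simp)]
    obtain ⟨h1, h2⟩ := h
    rw [← mul_div_assoc, div_lt_iff₀ hn] at h1
    rw [← mul_div_assoc, le_div_iff₀ hn] at h2
    constructor
    · rw [lt_div_iff₀ ht]; simpa using h1
    · rw [div_le_iff₀ ht]; exact h2
  rw [gridPoint, this]

theorem gridPoint_bounds {t : ℝ} (ht : 0 < t) (n : ℕ) {τ : ℝ} (h : τ ∈ Ioc 0 t) :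
    τ ≤ gridPoint t n τ ∧ gridPoint t n τ ≤ t ∧ 0 ≤ gridPoint t n τ - t / (n + 1) ∧
      gridPoint t n τ - t / (n + 1) < τ := by
  have hn : (0 : ℝ) < n + 1 := by positivity
  have hpos : 0 < τ * (n + 1) / t := div_pos (mul_pos h.1 hn) ht
  have h1 := Nat.le_ceil (τ * (n + 1) / t)
  have h2 := Nat.ceil_lt_add_one hpos.le
  have h3 : (1 : ℝ) ≤ ⌈τ * (n + 1) / t⌉₊ := by exact_mod_cast Nat.ceil_pos.2 hpos
  have h4 : (⌈τ * (n + 1) / t⌉₊ : ℝ) ≤ n + 1 := by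
    have : ⌈τ * (n + 1) / t⌉₊ ≤ n + 1 := Nat.ceil_le.2 (by
      rw [div_le_iff₀ ht]; push_cast; nlinarith [h.2])
    exact_mod_cast this
  have hδ : 0 < t / (n + 1) := div_pos ht hn
  have e : τ * (n + 1) / t * (t / (n + 1)) = τ := by field_simp
  have e' : ((n : ℝ) + 1) * (t / (n + 1)) = t := by field_simp
  unfold gridPoint
  refine ⟨?_, ?_, ?_, ?_⟩ <;> nlinarith

theorem tendsto_gridPoint {t : ℝ} (ht : 0 < t) {τ : ℝ} (h : τ ∈ Ioc 0 t) :
    Tendsto (fun n => gridPoint t n τ) atTop (𝓝 τ) ∧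
      Tendsto (fun n : ℕ => gridPoint t n τ - t / (n + 1)) atTop (𝓝 τ) := by
  have h0 : Tendsto (fun n : ℕ => t / ((n : ℝ) + 1)) atTop (𝓝 0) :=
    tendsto_const_div_atTop_nhds_zero_nat t |>.comp (tendsto_add_atTop_nat 1) |>.congr
      fun n => by simp
  have h1 : Tendsto (fun n => gridPoint t n τ) atTop (𝓝 τ) := by
    refine tendsto_of_tendsto_of_tendsto_of_le_of_le tendsto_const_nhds
      (by simpa using h0.const_add τ) (fun n => (gridPoint_bounds ht n h).1) fun n => ?_
    have := (gridPoint_bounds ht n h).2.2.2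
    simp only
    linarith
  exact ⟨h1, by simpa using h1.sub h0⟩

/-- The densities are only weakly continuous in time, so the product is not differentiated directly.
The exact increment formula is summed over a fine grid, and the frozen times converge to `τ`. -/
theorem IsFlow.overlap_eq (h₁ : IsFlow T α β M₁ ρ₁ K₁) (h₂ : IsFlow T α β M₂ ρ₂ K₂) (hT : 0 < T)
    {t : ℝ} (ht0 : 0 < t) (htT : t ≤ T) :
    (∫ x in α..β, (∫ y in α..x, ρ₂ t y) * ρ₁ t x) - (∫ x in α..β, (∫ y in α..x, ρ₂ 0 y) * ρ₁ 0 x) =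
      ∫ τ in 0..t, ((∫ x in α..β, K₂ τ x * ρ₁ τ x) - ∫ x in α..β, K₁ τ x * ρ₂ τ x) := by
  have hαβ := h₁.lt.le
  set L : ℝ → ℝ := fun t => ∫ x in α..β, (∫ y in α..x, ρ₂ t y) * ρ₁ t x with hL
  -- In each cell `ρ₁` is evaluated at the right endpoint and `ρ₂` at the left one, as the increment
  -- formula requires.
  set Q : ℕ → ℝ → ℝ := fun n τ => (∫ x in α..β, K₂ τ x * ρ₁ (gridPoint t n τ) x) -
    ∫ x in α..β, K₁ τ x * ρ₂ (gridPoint t n τ - t / (n + 1)) x with hQ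
  have hpiece : ∀ n k : ℕ, k < n + 1 →
      IntervalIntegrable (Q n) volume (k * (t / (n + 1))) ((k + 1 : ℕ) * (t / (n + 1))) ∧
      ∫ τ in (k * (t / (n + 1)))..((k + 1 : ℕ) * (t / (n + 1))), Q n τ =
        L ((k + 1 : ℕ) * (t / (n + 1))) - L (k * (t / (n + 1))) := by
    intro n k hk
    have hn : (0 : ℝ) < n + 1 := by positivity
    have hδ : 0 < t / (n + 1) := div_pos ht0 hn
    have a0 : (0 : ℝ) ≤ k * (t / (n + 1)) := by positivity
    have a1 : k * (t / (n + 1)) ≤ ((k + 1 : ℕ) : ℝ) * (t / (n + 1)) := by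
      gcongr; exact_mod_cast Nat.le_succ k
    have a2 : ((k + 1 : ℕ) : ℝ) * (t / (n + 1)) ≤ T := by
      have : ((k + 1 : ℕ) : ℝ) ≤ n + 1 := by exact_mod_cast hk
      calc ((k + 1 : ℕ) : ℝ) * (t / (n + 1)) ≤ (n + 1) * (t / (n + 1)) := by gcongr
        _ = t := by field_simp
        _ ≤ T := htT
    have hk1 : ((k + 1 : ℕ) : ℝ) * (t / (n + 1)) ∈ Icc 0 T := ⟨a0.trans a1, a2⟩
    have hk0 : (k : ℝ) * (t / (n + 1)) ∈ Icc 0 T := ⟨a0, a1.trans a2⟩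
    have heq : EqOn (fun τ => (∫ x in α..β, K₂ τ x * ρ₁ ((k + 1 : ℕ) * (t / (n + 1))) x) -
        ∫ x in α..β, K₁ τ x * ρ₂ (k * (t / (n + 1))) x) (Q n)
        (Ioc (k * (t / (n + 1))) ((k + 1 : ℕ) * (t / (n + 1)))) := by
      intro τ hτ
      have e2 : ((k + 1 : ℕ) : ℝ) * (t / (n + 1)) - t / (n + 1) = k * (t / (n + 1)) := by
        push_cast; ring
      simp only [hQ]
      rw [gridPoint_eq ht0 hτ, e2]
    have hi := (intervalIntegrable_integral_flux_mul h₂.flux a0 a1 a2 le_rfl hαβ le_rfl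
      (h₁.integrable _ hk1).1.aestronglyMeasurable (h₁.norm_le_one hT hk1)).sub
      (intervalIntegrable_integral_flux_mul h₁.flux a0 a1 a2 le_rfl hαβ le_rfl
      (h₂.integrable _ hk0).1.aestronglyMeasurable (h₂.norm_le_one hT hk0))
    constructor
    · refine hi.congr ?_
      rw [uIoc_of_le a1]
      exact heq
    · rw [hL]
      simp only
      rw [h₁.overlap_sub h₂ hT a0 a1 a2]
      refine (intervalIntegral.integral_congr_ae (ae_of_all _ fun τ hτ => ?_)).symm
      rw [uIoc_of_le a1] at hτ
      exact heq hτ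
  have hsum : ∀ n : ℕ, IntervalIntegrable (Q n) volume 0 t ∧ ∫ τ in 0..t, Q n τ = L t - L 0 := by
    intro n
    have hn : (0 : ℝ) < n + 1 := by positivity
    have e0 : ((0 : ℕ) : ℝ) * (t / (n + 1)) = 0 := by simp
    have e1 : ((n + 1 : ℕ) : ℝ) * (t / (n + 1)) = t := by push_cast; field_simp
    have h1 := IntervalIntegrable.trans_iterate (a := fun k : ℕ => (k : ℝ) * (t / (n + 1)))
      (n := n + 1) (fun k hk => (hpiece n k hk).1)
    have h2 := intervalIntegral.sum_integral_adjacent_intervals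
      (a := fun k : ℕ => (k : ℝ) * (t / (n + 1)))
      (n := n + 1) (fun k hk => (hpiece n k hk).1)
    rw [Finset.sum_congr rfl fun k hk => (hpiece n k (Finset.mem_range.1 hk)).2,
      Finset.sum_range_sub (fun k : ℕ => L ((k : ℝ) * (t / (n + 1))))] at h2
    simp only [e0, e1] at h1 h2
    exact ⟨h1, h2.symm⟩
  have habs : ∀ {K : ℝ → ℝ → ℝ}, IntegrableOn (Function.uncurry K) (Ioc 0 T ×ˢ Ioc α β) →
      IntervalIntegrable (fun τ => ∫ x in α..β, ‖K τ x‖) volume 0 t := fun {K} hK => by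
    have := intervalIntegrable_integral_flux_mul (K := fun τ x => ‖K τ x‖) (g := fun _ => 1)
      (C := 1) (T := T) hK.norm le_rfl ht0.le htT le_rfl hαβ le_rfl aestronglyMeasurable_const
      (by simp)
    simpa using this
  have hbound : ∀ {K ρ : ℝ → ℝ → ℝ} {M τ r : ℝ}, IsFlow T α β M ρ K → r ∈ Icc 0 T →
      ∀ k : ℝ → ℝ, IntervalIntegrable k volume α β →
        ‖∫ x in α..β, k x * ρ r x‖ ≤ ∫ x in α..β, ‖k x‖ := by
    intro K ρ M τ r h hr k hk
    refine intervalIntegral.norm_integral_le_of_norm_le hαβ ?_ hk.norm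
    rw [← ae_restrict_iff' measurableSet_Ioc]
    filter_upwards [h.norm_le_one hT hr] with x hx
    rw [norm_mul]
    exact mul_le_of_le_one_right (norm_nonneg _) hx
  have hslice : ∀ {K : ℝ → ℝ → ℝ}, IntegrableOn (Function.uncurry K) (Ioc 0 T ×ˢ Ioc α β) →
      ∀ᵐ τ, τ ∈ uIoc 0 t → IntervalIntegrable (K τ) volume α β := fun hK => by
    rw [uIoc_of_le ht0.le, ← ae_restrict_iff' measurableSet_Ioc]
    exact ae_restrict_of_ae_restrict_of_subset (Ioc_subset_Ioc_right htT)
      (ae_integrable_flux_slice hK hαβ)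
  have hlim : Tendsto (fun n => ∫ τ in 0..t, Q n τ) atTop
      (𝓝 (∫ τ in 0..t, ((∫ x in α..β, K₂ τ x * ρ₁ τ x) - ∫ x in α..β, K₁ τ x * ρ₂ τ x))) := by
    -- The densities are bounded by 1, so the `L¹` norms of the flux slices dominate. Pointwise
    -- convergence is weak continuity tested against the fixed integrable slices at time `τ`.
    refine intervalIntegral.tendsto_integral_filter_of_dominated_convergence
      (fun τ => (∫ x in α..β, ‖K₂ τ x‖) + ∫ x in α..β, ‖K₁ τ x‖) ?_ ?_
      ((habs h₂.flux).add (habs h₁.flux)) ?_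
    · exact Eventually.of_forall fun n => (intervalIntegrable_iff.1 (hsum n).1).aestronglyMeasurable
    · refine Eventually.of_forall fun n => ?_
      filter_upwards [hslice h₁.flux, hslice h₂.flux] with τ hk1 hk2 hτ
      have hτ' := hτ
      rw [uIoc_of_le ht0.le] at hτ'
      obtain ⟨g1, g2, g3, g4⟩ := gridPoint_bounds ht0 n hτ'
      have hδ : 0 < t / ((n : ℝ) + 1) := by positivity
      refine (norm_sub_le _ _).trans (add_le_add ?_ ?_)
      · exact hbound (τ := τ) h₁ ⟨hτ'.1.le.trans g1, g2.trans htT⟩ _ (hk2 hτ)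
      · exact hbound (τ := τ) h₂ ⟨g3, by linarith⟩ _ (hk1 hτ)
    · filter_upwards [hslice h₁.flux, hslice h₂.flux] with τ hk1 hk2 hτ
      have hτ' := hτ
      rw [uIoc_of_le ht0.le] at hτ'
      have hτT : τ ∈ Icc 0 T := ⟨hτ'.1.le, hτ'.2.trans htT⟩
      obtain ⟨t1, t2⟩ := tendsto_gridPoint ht0 hτ'
      have c1 := h₁.continuousOn_integral_mul hT (hk2 hτ) τ hτT
      have c2 := h₂.continuousOn_integral_mul hT (hk1 hτ) τ hτT
      simp_rw [mul_comm (ρ₁ _ _)] at c1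
      simp_rw [mul_comm (ρ₂ _ _)] at c2
      refine Tendsto.sub (c1.tendsto.comp (tendsto_nhdsWithin_iff.2 ⟨t1, ?_⟩))
        (c2.tendsto.comp (tendsto_nhdsWithin_iff.2 ⟨t2, ?_⟩))
      · refine Eventually.of_forall fun n => ?_
        obtain ⟨g1, g2, g3, g4⟩ := gridPoint_bounds ht0 n hτ'
        exact ⟨hτ'.1.le.trans g1, g2.trans htT⟩
      · refine Eventually.of_forall fun n => ?_
        obtain ⟨g1, g2, g3, g4⟩ := gridPoint_bounds ht0 n hτ'
        have hδ : 0 < t / ((n : ℝ) + 1) := by positivity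
        exact ⟨g3, by linarith⟩
  simp_rw [(hsum _).2] at hlim
  exact tendsto_nhds_unique tendsto_const_nhds hlim

/-- If the drifts push the first species to the right relative to the second one, then the
mass of the pairs of particles in which the second species is on the left does not decrease. -/
theorem IsFlow.overlap_mono (h₁ : IsFlow T α β M₁ ρ₁ K₁) (h₂ : IsFlow T α β M₂ ρ₂ K₂) (hT : 0 < T)
    (hK : ∀ᵐ τ ∂volume.restrict (Ioc 0 T), ∀ᵐ x ∂volume.restrict (Ioc α β),
      K₁ τ x * ρ₂ τ x ≤ K₂ τ x * ρ₁ τ x) {t : ℝ} (ht : t ∈ Icc 0 T) :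
    ∫ x in α..β, (∫ y in α..x, ρ₂ 0 y) * ρ₁ 0 x ≤ ∫ x in α..β, (∫ y in α..x, ρ₂ t y) * ρ₁ t x := by
  rcases ht.1.eq_or_lt with rfl | ht0
  · exact le_rfl
  have hαβ := h₁.lt.le
  rw [← sub_nonneg, h₁.overlap_eq h₂ hT ht0 ht.2]
  refine intervalIntegral.integral_nonneg_of_ae_restrict ht0.le ?_
  rw [← restrict_Ioc_eq_restrict_Icc]
  refine ae_restrict_of_ae_restrict_of_subset (Ioc_subset_Ioc_right ht.2) ?_
  filter_upwards [hK, ae_integrable_flux_slice h₁.flux hαβ, ae_integrable_flux_slice h₂.flux hαβ,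
    ae_restrict_mem measurableSet_Ioc] with τ h1 i1 i2 hτ
  have hτ' := Ioc_subset_Icc_self hτ
  rw [intervalIntegrable_iff_integrableOn_Ioc_of_le hαβ] at i1 i2
  have j1 := i1.mul_bdd (h₂.integrable τ hτ').1.aestronglyMeasurable (h₂.norm_le_one hT hτ')
  have j2 := i2.mul_bdd (h₁.integrable τ hτ').1.aestronglyMeasurable (h₁.norm_le_one hT hτ')
  simp only [Pi.zero_apply, sub_nonneg]
  rw [intervalIntegral.integral_of_le hαβ, intervalIntegral.integral_of_le hαβ]
  exact integral_mono_ae j1 j2 h1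

/-- The hypothesis says that `∫ (m₂ - F₂) f₁ ≤ 0`, although the integrand is nonnegative. The
monotone factor `m₂ - F₂` then vanishes as soon as some mass of `f₁` lies to the left. -/
theorem exists_separating_point {f₁ f₂ : ℝ → ℝ} {a b m₁ m₂ : ℝ} (hab : a ≤ b)
    (h₁ : IntervalIntegrable f₁ volume a b) (h₂ : IntervalIntegrable f₂ volume a b)
    (n₁ : ∀ᵐ x ∂volume.restrict (Ioc a b), 0 ≤ f₁ x)
    (n₂ : ∀ᵐ x ∂volume.restrict (Ioc a b), 0 ≤ f₂ x)
    (e₁ : ∫ x in a..b, f₁ x = m₁) (e₂ : ∫ x in a..b, f₂ x = m₂) (hm₁ : 0 < m₁)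
    (h : m₁ * m₂ ≤ ∫ x in a..b, (∫ y in a..x, f₂ y) * f₁ x) :
    ∃ z ∈ Icc a b, ∫ x in a..z, f₁ x = 0 ∧ ∫ x in z..b, f₂ x = 0 := by
  have hF : ∀ {f : ℝ → ℝ}, IntervalIntegrable f volume a b →
      ContinuousOn (fun x => ∫ y in a..x, f y) (Icc a b) := fun hf => by
    have := (hf.absolutelyContinuousOnInterval_intervalIntegral (c := a) left_mem_uIcc).continuousOn
    rwa [uIcc_of_le hab] at this
  have hsub : ∀ {f : ℝ → ℝ}, IntervalIntegrable f volume a b → ∀ u v, a ≤ u → u ≤ v → v ≤ b →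
      IntervalIntegrable f volume u v := fun hf u v h1 h2 h3 => hf.mono_set (by
    rw [uIcc_of_le h2, uIcc_of_le hab]; exact Icc_subset_Icc h1 h3)
  have hnn : ∀ {f : ℝ → ℝ}, (∀ᵐ x ∂volume.restrict (Ioc a b), 0 ≤ f x) → ∀ u v, a ≤ u → u ≤ v →
      v ≤ b → 0 ≤ ∫ x in u..v, f x := fun hf u v h1 h2 h3 => by
    refine intervalIntegral.integral_nonneg_of_ae_restrict h2 ?_
    rw [← restrict_Ioc_eq_restrict_Icc]
    exact ae_restrict_of_ae_restrict_of_subset (Ioc_subset_Ioc h1 h3) hf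
  -- As `m₂ - F₂` is nonincreasing, its value at `x` times `F₁(x)` is at most the integral of `(m₂ -
  -- F₂) f₁` over `(a, x)`.
  have hprod : ∀ x ∈ Icc a b, (m₂ - ∫ y in a..x, f₂ y) * ∫ y in a..x, f₁ y = 0 := by
    intro x hx
    have htail : ∀ y ∈ Icc a b, m₂ - ∫ z in a..y, f₂ z = ∫ z in y..b, f₂ z := fun y hy => by
      rw [← e₂, intervalIntegral.integral_interval_sub_left (hsub h₂ a b le_rfl hab le_rfl)
        (hsub h₂ a y le_rfl hy.1 hy.2)]
    have hci : IntervalIntegrable (fun y => (m₂ - ∫ z in a..y, f₂ z) * f₁ y) volume a b :=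
      h₁.continuousOn_mul (by rw [uIcc_of_le hab]; exact continuousOn_const.sub (hF h₂))
    have hle : ∫ y in a..b, (m₂ - ∫ z in a..y, f₂ z) * f₁ y ≤ 0 := by
      simp_rw [sub_mul]
      rw [intervalIntegral.integral_sub (h₁.const_mul _)
        (h₁.continuousOn_mul (by rw [uIcc_of_le hab]; exact hF h₂)),
        intervalIntegral.integral_const_mul, e₁]
      linarith
    have hadd := intervalIntegral.integral_add_adjacent_intervals
      (hsub hci a x le_rfl hx.1 hx.2) (hsub hci x b hx.1 hx.2 le_rfl)
    have hpos : ∀ᵐ y ∂volume.restrict (Ioc a b), 0 ≤ (m₂ - ∫ z in a..y, f₂ z) * f₁ y := by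
      filter_upwards [n₁, ae_restrict_mem measurableSet_Ioc] with y hy hym
      refine mul_nonneg ?_ hy
      rw [htail y (Ioc_subset_Icc_self hym)]
      exact hnn n₂ _ _ hym.1.le hym.2 le_rfl
    have hright := hnn hpos x b hx.1 hx.2 le_rfl
    have hleft : (m₂ - ∫ y in a..x, f₂ y) * ∫ y in a..x, f₁ y ≤
        ∫ y in a..x, (m₂ - ∫ z in a..y, f₂ z) * f₁ y := by
      rw [← intervalIntegral.integral_const_mul]
      refine intervalIntegral.integral_mono_ae_restrict hx.1
        ((hsub h₁ a x le_rfl hx.1 hx.2).const_mul _) (hsub hci a x le_rfl hx.1 hx.2) ?_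
      rw [← restrict_Ioc_eq_restrict_Icc]
      filter_upwards [ae_restrict_of_ae_restrict_of_subset (Ioc_subset_Ioc_right hx.2) n₁,
        ae_restrict_mem measurableSet_Ioc] with y hy hym
      refine mul_le_mul_of_nonneg_right ?_ hy
      have := hnn n₂ y x hym.1.le hym.2 hx.2
      rw [← intervalIntegral.integral_interval_sub_left (hsub h₂ a x le_rfl hx.1 hx.2)
        (hsub h₂ a y le_rfl hym.1.le (hym.2.trans hx.2))] at this
      linarith
    refine le_antisymm (by linarith) (mul_nonneg ?_ (hnn n₁ a x le_rfl hx.1 hx.2))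
    rw [htail x hx]
    exact hnn n₂ x b hx.1 hx.2 le_rfl
  have hcomp : IsCompact (Icc a b ∩ (fun x => ∫ y in a..x, f₁ y) ⁻¹' {0}) :=
    (isCompact_Icc).of_isClosed_subset
      ((hF h₁).preimage_isClosed_of_isClosed isClosed_Icc isClosed_singleton) inter_subset_left
  -- The last zero of `F₁`: to its right `F₁` does not vanish, hence `F₂ = m₂` there, and at `z`
  -- itself by continuity.
  obtain ⟨z, ⟨hzm, hz0⟩, hzub⟩ := hcomp.exists_isGreatest ⟨a, ⟨le_rfl, hab⟩, by simp⟩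
  have hz0' : ∫ y in a..z, f₁ y = 0 := hz0
  refine ⟨z, hzm, hz0', ?_⟩
  have hzb : z < b := hzm.2.lt_of_ne (by rintro rfl; linarith)
  have hfun : ∀ x ∈ Ioo z b, ∫ y in a..x, f₂ y = m₂ := by
    intro x hx
    have hxm : x ∈ Icc a b := ⟨hzm.1.trans hx.1.le, hx.2.le⟩
    rcases mul_eq_zero.1 (hprod x hxm) with h0 | h0
    · linarith
    · exact absurd (hzub ⟨hxm, h0⟩) (not_le.2 hx.1)
  have hlim : Tendsto (fun x => ∫ y in a..x, f₂ y) (𝓝[Ioo z b] z) (𝓝 (∫ y in a..z, f₂ y)) :=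
    (hF h₂ z hzm).mono fun x hx => ⟨hzm.1.trans hx.1.le, hx.2.le⟩
  have hne : (𝓝[Ioo z b] z).NeBot := by
    rw [nhdsWithin_Ioo_eq_nhdsGT hzb]; infer_instance
  have hz2 := tendsto_nhds_unique (hlim.congr' (by
    filter_upwards [self_mem_nhdsWithin] with x hx using hfun x hx)) tendsto_const_nhds
  rw [← intervalIntegral.integral_interval_sub_left (hsub h₂ a b le_rfl hab le_rfl)
        (hsub h₂ a z le_rfl hzm.1 hzm.2), hz2, e₂, sub_self]

end Ordering

/-! ### Convexity and affinity criteria; contraction towards the barycenter -/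

section Convexity

/-- A continuous function is convex if, at every point, it either touches a convex function
from above or is midpoint convex at small scales. -/
theorem convexOn_of_touching_or_midpoint {V : ℝ → ℝ} {l r : ℝ} (hV : ContinuousOn V (Ioo l r))
    (h : ∀ z ∈ Ioo l r,
      (∃ Φ : ℝ → ℝ, ConvexOn ℝ (Ioo l r) Φ ∧ (∀ x ∈ Ioo l r, Φ x ≤ V x) ∧ Φ z = V z) ∨
        ∀ᶠ δ in 𝓝[>] (0 : ℝ), 2 * V z ≤ V (z - δ) + V (z + δ)) :
    ConvexOn ℝ (Ioo l r) V := by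
  refine LinearOrder.convexOn_of_lt (convex_Ioo l r) fun x hx y hy hxy a b ha hb hab => ?_
  simp only [smul_eq_mul]
  have hyx : 0 < y - x := sub_pos.2 hxy
  set k := (V y - V x) / (y - x) with hk
  have hkm : k * (y - x) = V y - V x := by rw [hk]; field_simp
  -- The excess of `V` over its chord; if convexity fails, it has a positive maximum inside.
  set D : ℝ → ℝ := fun u => V u - (V x + k * (u - x)) with hD
  have hsub : Icc x y ⊆ Ioo l r := fun u hu => ⟨hx.1.trans_le hu.1, hu.2.trans_lt hy.2⟩
  have hDc : ContinuousOn D (Icc x y) := (hV.mono hsub).sub (by fun_prop)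
  have hDx : D x = 0 := by simp [hD]
  have hDy : D y = 0 := by simp only [hD]; linarith
  by_contra hcon
  rw [not_le] at hcon
  have hw : a * x + b * y ∈ Icc x y := by
    have ha1 : a = 1 - b := by linarith
    have hb1 := mul_pos hb hyx
    have hb2 := mul_pos ha hyx
    rw [ha1] at hb2 ⊢
    constructor <;> linarith
  have hDw : 0 < D (a * x + b * y) := by
    have e : a * x + b * y - x = b * (y - x) := by
      have : a = 1 - b := by linarith
      rw [this]; ring
    have e2 : k * (b * (y - x)) = b * (V y - V x) := by rw [← hkm]; ring
    simp only [hD, e, e2]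
    have : a = 1 - b := by linarith
    rw [this] at hcon ⊢
    linarith
  obtain ⟨z₀, hz₀, hmax⟩ := isCompact_Icc.exists_isMaxOn ⟨_, hw⟩ hDc
  have hm : 0 < D z₀ := hDw.trans_le (hmax hw)
  have hcomp : IsCompact (Icc x y ∩ D ⁻¹' {D z₀}) := isCompact_Icc.of_isClosed_subset
    (hDc.preimage_isClosed_of_isClosed isClosed_Icc isClosed_singleton) inter_subset_left
  -- At the leftmost maximum point the value at `z - δ` is strictly smaller, which contradicts
  -- midpoint convexity. A touching convex function instead forces `D z ≤ 0`.
  obtain ⟨z, ⟨hzm, hz⟩, hleast⟩ := hcomp.exists_isLeast ⟨z₀, hz₀, rfl⟩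
  have hz' : D z = D z₀ := hz
  have hxz : x < z := hzm.1.lt_of_ne (by rintro rfl; linarith)
  have hzy : z < y := hzm.2.lt_of_ne (by rintro rfl; linarith)
  rcases h z (hsub hzm) with ⟨Φ, hΦ, hle, heq⟩ | hmid
  · have h1 := hΦ.2 hx hy (show 0 ≤ (y - z) / (y - x) from div_nonneg (by linarith) hyx.le)
      (show 0 ≤ (z - x) / (y - x) from div_nonneg (by linarith) hyx.le) (by field_simp; ring)
    have e : (y - z) / (y - x) * x + (z - x) / (y - x) * y = z := by field_simp; ring
    simp only [smul_eq_mul, e] at h1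
    have h2 : (y - z) / (y - x) * Φ x ≤ (y - z) / (y - x) * V x :=
      mul_le_mul_of_nonneg_left (hle x hx) (div_nonneg (by linarith) hyx.le)
    have h3 : (z - x) / (y - x) * Φ y ≤ (z - x) / (y - x) * V y :=
      mul_le_mul_of_nonneg_left (hle y hy) (div_nonneg (by linarith) hyx.le)
    have e2 : (y - z) / (y - x) * V x + (z - x) / (y - x) * V y = V x + k * (z - x) := by
      rw [hk]; field_simp; ring
    have : D z ≤ 0 := by simp only [hD]; linarith
    linarith
  · obtain ⟨δ, hδ, hδ2⟩ := (hmid.and (Ioo_mem_nhdsGT (lt_min (sub_pos.2 hxz)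
      (sub_pos.2 hzy)))).exists
    have d1 : δ < z - x := hδ2.2.trans_le (min_le_left _ _)
    have d2 : δ < y - z := hδ2.2.trans_le (min_le_right _ _)
    have d0 : 0 < δ := hδ2.1
    have m1 : z - δ ∈ Icc x y := ⟨by linarith, by linarith⟩
    have m2 : z + δ ∈ Icc x y := ⟨by linarith, by linarith⟩
    have l1 : D (z - δ) ≤ D z₀ := hmax m1
    have l2 : D (z + δ) ≤ D z₀ := hmax m2
    have l3 : D (z - δ) ≠ D z₀ := fun he => by
      have := hleast ⟨m1, he⟩
      linarith
    have l4 := lt_of_le_of_ne l1 l3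
    have e1 : D (z - δ) + D (z + δ) - 2 * D z = V (z - δ) + V (z + δ) - 2 * V z := by
      simp only [hD]; ring
    linarith

/-- Both sides are continuous in the pair `(c, δ)` on an open set, in which rational pairs are
dense. -/
theorem midpoint_of_rat {V : ℝ → ℝ} {l r : ℝ} (hV : ContinuousOn V (Ioo l r))
    (h : ∀ c δ : ℚ, (0 : ℝ) < δ → l < c - δ → (c + δ : ℝ) < r →
      2 * V c = V (c - δ) + V (c + δ)) {c δ : ℝ} (hδ : 0 < δ) (hl : l < c - δ) (hr : c + δ < r) :
    2 * V c = V (c - δ) + V (c + δ) := by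
  set U : Set (ℝ × ℝ) := {p | 0 < p.2 ∧ l < p.1 - p.2 ∧ p.1 + p.2 < r} with hU
  have u1 : IsOpen {p : ℝ × ℝ | 0 < p.2} := isOpen_lt (by fun_prop) (by fun_prop)
  have u2 : IsOpen {p : ℝ × ℝ | l < p.1 - p.2} := isOpen_lt (by fun_prop) (by fun_prop)
  have u3 : IsOpen {p : ℝ × ℝ | p.1 + p.2 < r} := isOpen_lt (by fun_prop) (by fun_prop)
  have hUo : IsOpen U := u1.inter (u2.inter u3)
  have hdense : Dense (range fun q : ℚ × ℚ => ((q.1 : ℝ), (q.2 : ℝ))) := by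
    have := Rat.denseRange_cast (𝕜 := ℝ)
    exact this.prodMap this
  have hf : ContinuousOn (fun p : ℝ × ℝ => 2 * V p.1) U :=
    continuousOn_const.mul (hV.comp (by fun_prop) fun p hp =>
      ⟨by linarith [hp.1, hp.2.1], by linarith [hp.1, hp.2.2]⟩)
  have hg : ContinuousOn (fun p : ℝ × ℝ => V (p.1 - p.2) + V (p.1 + p.2)) U :=
    (hV.comp (by fun_prop) fun p hp => ⟨hp.2.1, by linarith [hp.1, hp.2.2]⟩).add
      (hV.comp (by fun_prop) fun p hp => ⟨by linarith [hp.1, hp.2.1], hp.2.2⟩)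
  have heq : EqOn (fun p : ℝ × ℝ => 2 * V p.1) (fun p : ℝ × ℝ => V (p.1 - p.2) + V (p.1 + p.2))
      (U ∩ range fun q : ℚ × ℚ => ((q.1 : ℝ), (q.2 : ℝ))) := by
    rintro p ⟨hp, q, rfl⟩
    exact h q.1 q.2 hp.1 hp.2.1 hp.2.2
  exact heq.of_subset_closure hf hg inter_subset_left (hdense.open_subset_closure_inter hUo)
    (show (c, δ) ∈ U from ⟨hδ, hl, hr⟩)

/-- The midpoint identity applies to `V` and to `-V`, so `V` is both convex and concave and adjacent
slopes agree. -/
theorem affine_of_midpoint {V : ℝ → ℝ} {l r : ℝ} (hlr : l < r) (hV : ContinuousOn V (Ioo l r))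
    (h : ∀ c δ : ℝ, 0 < δ → l < c - δ → c + δ < r → 2 * V c = V (c - δ) + V (c + δ)) :
    ∃ w e : ℝ, ∀ x ∈ Ioo l r, V x = w * x + e := by
  have hev : ∀ z ∈ Ioo l r, ∀ᶠ δ in 𝓝[>] (0 : ℝ), 2 * V z = V (z - δ) + V (z + δ) := by
    intro z hz
    filter_upwards [Ioo_mem_nhdsGT (lt_min (sub_pos.2 hz.1) (sub_pos.2 hz.2))] with δ hδ
    have d1 := hδ.2.trans_le (min_le_left _ _)
    have d2 := hδ.2.trans_le (min_le_right _ _)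
    exact h z δ hδ.1 (by linarith) (by linarith)
  have hconv := convexOn_of_touching_or_midpoint hV fun z hz =>
    Or.inr ((hev z hz).mono fun δ hδ => hδ.le)
  have hconc : ConcaveOn ℝ (Ioo l r) V := by
    have := convexOn_of_touching_or_midpoint hV.neg fun z hz =>
      Or.inr ((hev z hz).mono fun δ hδ => by
        show 2 * -V z ≤ -V (z - δ) + -V (z + δ)
        linarith)
    exact neg_convexOn_iff.1 this
  have key : ∀ x ∈ Ioo l r, ∀ z ∈ Ioo l r, ∀ y, x < y → y < z →
      (V y - V x) * (z - y) = (V z - V y) * (y - x) := by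
    intro x hx z hz y hxy hyz
    have h1 := hconv.slope_mono_adjacent hx hz hxy hyz
    have h2 := hconc.slope_anti_adjacent hx hz hxy hyz
    have h3 := le_antisymm h1 h2
    rwa [div_eq_div_iff (sub_pos.2 hxy).ne' (sub_pos.2 hyz).ne'] at h3
  obtain ⟨x₀, h0l, h0r⟩ := exists_between hlr
  obtain ⟨x₁, h01, h1r⟩ := exists_between h0r
  have hpos : 0 < x₁ - x₀ := sub_pos.2 h01
  have m0 : x₀ ∈ Ioo l r := ⟨h0l, h0r⟩
  have m1 : x₁ ∈ Ioo l r := ⟨h0l.trans h01, h1r⟩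
  refine ⟨(V x₁ - V x₀) / (x₁ - x₀), V x₀ - (V x₁ - V x₀) / (x₁ - x₀) * x₀, fun x hx => ?_⟩
  have goal : (V x - V x₀) * (x₁ - x₀) = (V x₁ - V x₀) * (x - x₀) := by
    rcases lt_trichotomy x x₀ with hx0 | rfl | hx0
    · have := key x hx x₁ m1 x₀ hx0 h01
      linarith
    · ring
    · rcases lt_trichotomy x x₁ with hx1 | rfl | hx1
      · have := key x₀ m0 x₁ m1 x hx0 hx1
        linarith
      · ring
      · have := key x₀ m0 x hx x₁ h01 hx1
        linarith
  have := eq_div_of_mul_eq hpos.ne' goal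
  rw [mul_div_right_comm] at this
  linarith

/-- A density supported in an interval, on which the potential `V` is convex, is contracted
towards its barycenter by the flow of `-V'`. -/
theorem integral_sub_barycenter_mul_nonneg {f U V : ℝ → ℝ} {a b l r m M : ℝ} (hab : a ≤ b)
    (hf : IntervalIntegrable f volume a b)
    (h0 : ∀ᵐ x ∂volume.restrict (Ioc a b), 0 ≤ f x) (hM : 0 < M) (hfM : ∫ x in a..b, f x = M)
    (hm : ∫ x in a..b, f x * x = M * m)
    (hsupp : ∀ᵐ x ∂volume.restrict (Ioc a b), x ∉ Ioo l r → f x = 0)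
    (hV : ConvexOn ℝ (Ioo l r) V) (hU : ∀ᵐ x, x ∈ Ioo l r → HasDerivAt V (U x) x)
    (hi : IntervalIntegrable (fun x => U x * f x) volume a b) :
    0 ≤ ∫ x in a..b, (U x * f x) * (x - m) := by
  have hfx : IntervalIntegrable (fun x => f x * x) volume a b := hf.mul_continuousOn (by fun_prop)
  have hshift : ∀ p, ∫ x in a..b, f x * (x - p) = M * (m - p) := fun p => by
    simp_rw [mul_sub]
    rw [intervalIntegral.integral_sub hfx (hf.mul_const p), intervalIntegral.integral_mul_const,
      hm, hfM]
  have hne : ∀ p, (∀ᵐ x ∂volume.restrict (Ioc a b), f x * (x - p) = 0) → False := fun p hp => by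
    have hz : ∀ᵐ x ∂volume.restrict (Ioc a b), f x = 0 := by
      filter_upwards [hp, ae_restrict_of_ae
        (show ∀ᵐ x : ℝ, x ≠ p from compl_mem_ae_iff.2 (measure_singleton p))] with x hx hxp
      exact (mul_eq_zero.1 hx).resolve_right (sub_ne_zero.2 hxp)
    have : ∫ x in a..b, f x = 0 := by
      rw [intervalIntegral.integral_of_le hab]
      exact integral_eq_zero_of_ae hz
    linarith
  -- If the barycenter were at or left of `l`, the nonnegative function `f x * (x - l)` would have
  -- nonpositive integral, and `f` would vanish a.e., against `M > 0`.
  have hlm : l < m := by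
    by_contra hcon
    rw [not_lt] at hcon
    have hnn : 0 ≤ᵐ[volume.restrict (Ioc a b)] fun x => f x * (x - l) := by
      filter_upwards [h0, hsupp] with x hx hs
      by_cases hxm : x ∈ Ioo l r
      · exact mul_nonneg hx (sub_pos.2 hxm.1).le
      · simp [hs hxm]
    have hle : ∫ x in a..b, f x * (x - l) ≤ 0 := by rw [hshift]; nlinarith
    have hge := intervalIntegral.integral_nonneg_of_ae_restrict (μ := volume)
      (f := fun x => f x * (x - l)) hab (by rw [← restrict_Ioc_eq_restrict_Icc]; exact hnn)
    have := (intervalIntegral.integral_eq_zero_iff_of_le_of_nonneg_ae hab hnn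
      (hf.mul_continuousOn (by fun_prop))).1 (le_antisymm hle hge)
    exact hne l this
  have hmr : m < r := by
    by_contra hcon
    rw [not_lt] at hcon
    have hnn : 0 ≤ᵐ[volume.restrict (Ioc a b)] fun x => -(f x * (x - r)) := by
      filter_upwards [h0, hsupp] with x hx hs
      by_cases hxm : x ∈ Ioo l r
      · have := mul_nonneg hx (sub_pos.2 hxm.2).le
        simp only [Pi.zero_apply]
        linarith
      · simp [hs hxm]
    have hle : ∫ x in a..b, -(f x * (x - r)) ≤ 0 := by
      rw [intervalIntegral.integral_neg, hshift]; nlinarith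
    have hge := intervalIntegral.integral_nonneg_of_ae_restrict (μ := volume)
      (f := fun x => -(f x * (x - r))) hab (by rw [← restrict_Ioc_eq_restrict_Icc]; exact hnn)
    have := (intervalIntegral.integral_eq_zero_iff_of_le_of_nonneg_ae hab hnn
      (hf.mul_continuousOn (by fun_prop)).neg).1 (le_antisymm hle hge)
    exact hne r (this.mono fun x hx => by simpa using hx)
  have hmi : m ∈ interior (Ioo l r) := by rw [interior_Ioo]; exact ⟨hlm, hmr⟩
  have hmm : m ∈ Ioo l r := ⟨hlm, hmr⟩
  -- Subtracting this constant slope at the barycenter does not change the integral, and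
  -- monotonicity of `V'` makes `(U x - c) * (x - m)` nonnegative.
  set c := derivWithin V (Ioi m) m with hc
  have hci : IntervalIntegrable (fun x => c * (f x * (x - m))) volume a b :=
    (hf.mul_continuousOn (by fun_prop)).const_mul c
  have hzero : ∫ x in a..b, c * (f x * (x - m)) = 0 := by
    rw [intervalIntegral.integral_const_mul, hshift]; simp
  rw [← hzero]
  refine intervalIntegral.integral_mono_ae_restrict hab hci (hi.mul_continuousOn (by fun_prop)) ?_
  rw [← restrict_Ioc_eq_restrict_Icc]
  filter_upwards [h0, hsupp, ae_restrict_of_ae hU] with x hx hs hd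
  by_cases hxm : x ∈ Ioo l r
  · have hd' := hd hxm
    have hprod : 0 ≤ (U x - c) * (x - m) := by
      rcases lt_trichotomy x m with hlt | rfl | hgt
      · have h1 := hV.le_slope_of_hasDerivAt hxm hmm hlt hd'
        have h2 := hV.slope_le_leftDeriv_of_mem_interior hxm hmi hlt
        have h3 := hV.leftDeriv_le_rightDeriv_of_mem_interior hmi
        exact mul_nonneg_of_nonpos_of_nonpos (by linarith) (by linarith)
      · simp
      · have h1 := hV.slope_le_of_hasDerivAt hmm hxm hgt hd'
        have h2 := hV.rightDeriv_le_slope_of_mem_interior hmi hxm hgt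
        exact mul_nonneg (by linarith) (by linarith)
    nlinarith
  · simp [hs hxm]

end Convexity

/-! ### Minimality of intervals and decay of the variance -/

section Variance

/-- Among densities bounded by `1`, the indicators of intervals minimize the second moment. -/
theorem eq_indicator_of_second_moment_le {f : ℝ → ℝ} {a b m M : ℝ} (hab : a < b)
    (hf : IntervalIntegrable f volume a b)
    (h0 : ∀ᵐ x ∂volume.restrict (Ioc a b), 0 ≤ f x)
    (h1 : ∀ᵐ x ∂volume.restrict (Ioc a b), f x ≤ 1) (hM : 0 < M) (hfM : ∫ x in a..b, f x = M)
    (h2 : ∫ x in a..b, f x * (x - m) ^ 2 ≤ M ^ 3 / 12) :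
    a ≤ m - M / 2 ∧ m + M / 2 ≤ b ∧
      f =ᵐ[volume.restrict (Ioc a b)] (Ioo (m - M / 2) (m + M / 2)).indicator 1 := by
  set A := Ioo (m - M / 2) (m + M / 2) with hA
  -- Bathtub principle: `q` is negative exactly on `A`, so `(f - 1_A) q ≥ 0` for every density with
  -- values in `[0, 1]`. The bound `M ^ 3 / 12` is the second moment of `A` about `m`.
  set q : ℝ → ℝ := fun x => (x - m) ^ 2 - M ^ 2 / 4 with hq
  have hqc : Continuous q := by fun_prop
  -- Extension by zero allows a comparison on the whole line, before `A` is known to lie in `[a,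
  -- b]`.
  set g : ℝ → ℝ := (Ioc a b).indicator f with hg
  have hfi := (intervalIntegrable_iff_integrableOn_Ioc_of_le hab.le).1 hf
  have hfqi : IntervalIntegrable (fun x => f x * q x) volume a b :=
    hf.mul_continuousOn hqc.continuousOn
  have e1 : (fun x => g x * q x) = (Ioc a b).indicator fun x => f x * q x := by
    ext x; by_cases hx : x ∈ Ioc a b <;> simp [hg, hx]
  have e2 : (fun x => A.indicator 1 x * q x) = A.indicator q := by
    ext x; by_cases hx : x ∈ A <;> simp [hx]
  have i1 : Integrable fun x => g x * q x := by
    rw [e1, integrable_indicator_iff measurableSet_Ioc]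
    exact (intervalIntegrable_iff_integrableOn_Ioc_of_le hab.le).1 hfqi
  have i2 : Integrable fun x => A.indicator 1 x * q x := by
    rw [e2, integrable_indicator_iff measurableSet_Ioo]
    exact (hqc.integrableOn_Icc).mono_set Ioo_subset_Icc_self
  have v1 : ∫ x, g x * q x ≤ M ^ 3 / 12 - M ^ 2 / 4 * M := by
    rw [e1, integral_indicator measurableSet_Ioc, ← intervalIntegral.integral_of_le hab.le]
    simp only [hq, mul_sub]
    rw [intervalIntegral.integral_sub (hf.mul_continuousOn (by fun_prop)) (hf.mul_const _),
      intervalIntegral.integral_mul_const, hfM]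
    linarith
  have v2 : ∫ x, A.indicator 1 x * q x = M ^ 3 / 12 - M ^ 2 / 4 * M := by
    rw [e2, integral_indicator measurableSet_Ioo, ← integral_Ioc_eq_integral_Ioo,
      ← intervalIntegral.integral_of_le (by linarith)]
    simp only [hq]
    rw [intervalIntegral.integral_sub (by apply Continuous.intervalIntegrable; fun_prop) (by simp),
      intervalIntegral.integral_comp_sub_right (fun x => x ^ 2), integral_pow,
      intervalIntegral.integral_const, smul_eq_mul]
    push_cast
    ring
  have hg0 : ∀ᵐ x, 0 ≤ g x ∧ g x ≤ 1 := by
    filter_upwards [(ae_restrict_iff' measurableSet_Ioc).1 h0,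
      (ae_restrict_iff' measurableSet_Ioc).1 h1] with x hx0 hx1
    by_cases hx : x ∈ Ioc a b
    · simp only [hg, indicator_of_mem hx]; exact ⟨hx0 hx, hx1 hx⟩
    · simp [hg, indicator_of_notMem hx]
  have hqneg : ∀ x ∈ A, q x < 0 := fun x hx => by
    simp only [hq]; nlinarith [hx.1, hx.2]
  have hqpos : ∀ x ∉ A, 0 ≤ q x := fun x hx => by
    simp only [hA, mem_Ioo, not_and_or, not_lt] at hx
    simp only [hq]
    rcases hx with hx | hx <;> nlinarith
  have hnn : 0 ≤ᵐ[volume] fun x => g x * q x - A.indicator 1 x * q x := by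
    filter_upwards [hg0] with x hx
    simp only [Pi.zero_apply]
    by_cases hxA : x ∈ A
    · rw [indicator_of_mem hxA]
      have := hqneg x hxA
      simp only [Pi.one_apply]
      nlinarith [hx.2]
    · rw [indicator_of_notMem hxA]
      have := mul_nonneg hx.1 (hqpos x hxA)
      linarith
  have hint : ∫ x, (g x * q x - A.indicator 1 x * q x) = 0 := by
    refine le_antisymm ?_ (integral_nonneg_of_ae hnn)
    rw [integral_sub i1 i2]
    linarith
  have hz := (integral_eq_zero_iff_of_nonneg_ae hnn (i1.sub i2)).1 hint
  -- In the equality case the product vanishes a.e., and `q` is zero only at the two endpoints of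
  -- `A`.
  have hgA : ∀ᵐ x, g x = A.indicator 1 x := by
    filter_upwards [hz, compl_mem_ae_iff.2 (measure_singleton (m - M / 2)),
      compl_mem_ae_iff.2 (measure_singleton (m + M / 2))] with x hx n1 n2
    simp only [Pi.zero_apply, ← sub_mul] at hx
    refine sub_eq_zero.1 ((mul_eq_zero.1 hx).resolve_right fun h0 => ?_)
    have : (x - (m - M / 2)) * (x - (m + M / 2)) = 0 := by
      simp only [hq] at h0
      linear_combination h0
    rcases mul_eq_zero.1 this with h | h
    · exact n1 (sub_eq_zero.1 h)
    · exact n2 (sub_eq_zero.1 h)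
  have hnull : volume (A \ Ioc a b) = 0 := by
    refine measure_mono_null (fun x hx => ?_) hgA
    simp only [mem_compl_iff, mem_ofPred_eq]
    rw [indicator_of_mem hx.1, hg, indicator_of_notMem hx.2]
    simp
  refine ⟨?_, ?_, ?_⟩
  · by_contra hlt
    rw [not_le] at hlt
    have : volume (Ioo (m - M / 2) (min a (m + M / 2))) = 0 := by
      refine measure_mono_null (t := A \ Ioc a b) (fun x hx => ⟨⟨hx.1, hx.2.trans_le (min_le_right _ _)⟩, fun h =>
        absurd h.1 (not_lt.2 (hx.2.le.trans (min_le_left _ _)))⟩) hnull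
    rw [Real.volume_Ioo, ENNReal.ofReal_eq_zero] at this
    have : m - M / 2 < min a (m + M / 2) := lt_min hlt (by linarith)
    linarith
  · by_contra hlt
    rw [not_le] at hlt
    have : volume (Ioo (max b (m - M / 2)) (m + M / 2)) = 0 := by
      refine measure_mono_null (t := A \ Ioc a b) (fun x hx => ⟨⟨(le_max_right _ _).trans_lt hx.1, hx.2⟩, fun h =>
        absurd h.2 (not_le.2 ((le_max_left _ _).trans_lt hx.1))⟩) hnull
    rw [Real.volume_Ioo, ENNReal.ofReal_eq_zero] at this
    have : max b (m - M / 2) < m + M / 2 := max_lt hlt (by linarith)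
    linarith
  · refine (ae_restrict_iff' measurableSet_Ioc).2 ?_
    filter_upwards [hgA] with x hx hxm
    rw [← hx, hg, indicator_of_mem hxm]

variable {T α β M : ℝ} {ρ K : ℝ → ℝ → ℝ}

theorem IsFlow.firstMoment_eq (h : IsFlow T α β M ρ K) {t : ℝ} (ht : t ∈ Icc 0 T) :
    ∫ x in α..β, ρ t x * x =
      (∫ x in α..β, ρ 0 x * x) - ∫ τ in 0..t, ∫ x in α..β, K τ x := by
  simpa using h.moment_eq (ψ := fun x => x) contDiff_id ht

theorem IsFlow.intervalIntegrable_firstMoment (h : IsFlow T α β M ρ K) (hT : 0 ≤ T) :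
    IntervalIntegrable (fun τ => ∫ x in α..β, K τ x) volume 0 T := by
  simpa using h.intervalIntegrable_moment hT (ψ := fun x => x) contDiff_id

theorem second_moment_center {f : ℝ → ℝ} {a b m M : ℝ} (hf : IntervalIntegrable f volume a b)
    (hfM : ∫ x in a..b, f x = M) (hm : ∫ x in a..b, f x * x = M * m) :
    ∫ x in a..b, f x * (x - m) ^ 2 = (∫ x in a..b, f x * x ^ 2) - M * m ^ 2 := by
  have i2 : IntervalIntegrable (fun x => f x * x ^ 2) volume a b :=
    hf.mul_continuousOn (by fun_prop)
  have i1 : IntervalIntegrable (fun x => f x * x) volume a b := hf.mul_continuousOn (by fun_prop)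
  have e : ∀ x, f x * (x - m) ^ 2 = f x * x ^ 2 - 2 * m * (f x * x) + m ^ 2 * f x := fun x => by
    ring
  simp_rw [e]
  rw [intervalIntegral.integral_add (i2.sub (i1.const_mul _)) (hf.const_mul _),
    intervalIntegral.integral_sub i2 (i1.const_mul _), intervalIntegral.integral_const_mul,
    intervalIntegral.integral_const_mul, hm, hfM]
  ring

/-- The derivative of `∫ ρ x² - (∫ ρ x)² / M` is `-2 ∫ K (x - m)`, with `m` the barycenter, and this
is nonpositive by `hK`. -/
theorem IsFlow.variance_le (h : IsFlow T α β M ρ K) (hT : 0 < T) (hM : 0 < M)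
    (hK : ∀ᵐ t ∂volume.restrict (Ioc 0 T), ∀ m, ∫ x in α..β, ρ t x * x = M * m →
      0 ≤ ∫ x in α..β, K t x * (x - m)) {t : ℝ} (ht : t ∈ Icc 0 T) :
    (∫ x in α..β, ρ t x * x ^ 2) - (∫ x in α..β, ρ t x * x) ^ 2 / M ≤
      (∫ x in α..β, ρ 0 x * x ^ 2) - (∫ x in α..β, ρ 0 x * x) ^ 2 / M := by
  have hsq : ContDiff ℝ 1 fun x : ℝ => x ^ 2 := contDiff_id.pow 2
  have hdsq : deriv (fun x : ℝ => x ^ 2) = fun x => 2 * x := by ext x; simp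
  have hk1 := h.intervalIntegrable_firstMoment hT.le
  have hk2 := h.intervalIntegrable_moment hT.le hsq
  have hm2 := fun s (hs : s ∈ Icc 0 T) => h.moment_eq hsq hs
  rw [hdsq] at hk2 hm2
  -- The moments are replaced by primitives in time, which agree with them on `[0, T]` and are
  -- absolutely continuous by construction.
  set n₁ : ℝ → ℝ := fun s => (∫ x in α..β, ρ 0 x * x) - ∫ τ in 0..s, ∫ x in α..β, K τ x with hn₁
  set n₂ : ℝ → ℝ := fun s => (∫ x in α..β, ρ 0 x * x ^ 2) -
    ∫ τ in 0..s, ∫ x in α..β, K τ x * (2 * x) with hn₂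
  have h0m : (0 : ℝ) ∈ uIcc 0 T := left_mem_uIcc
  have hconst : ∀ c : ℝ, AbsolutelyContinuousOnInterval (fun _ : ℝ => c) 0 T := fun c =>
    contDiffOn_const.absolutelyContinuousOnInterval
  have ac1 : AbsolutelyContinuousOnInterval n₁ 0 T :=
    (hconst _).sub (hk1.absolutelyContinuousOnInterval_intervalIntegral h0m)
  have ac2 : AbsolutelyContinuousOnInterval n₂ 0 T :=
    (hconst _).sub (hk2.absolutelyContinuousOnInterval_intervalIntegral h0m)
  have acY : AbsolutelyContinuousOnInterval (fun s => n₂ s - M⁻¹ * (n₁ s * n₁ s)) 0 T :=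
    ac2.sub ((ac1.fun_mul ac1).const_mul M⁻¹)
  have hsub : uIcc 0 t ⊆ uIcc 0 T := by
    rw [uIcc_of_le ht.1, uIcc_of_le hT.le]; exact Icc_subset_Icc_right ht.2
  have hY := (acY.mono hsub).integral_deriv_eq_sub
  have hle : ∫ s in 0..t, deriv (fun s => n₂ s - M⁻¹ * (n₁ s * n₁ s)) s ≤ 0 := by
    rw [← neg_nonneg, ← intervalIntegral.integral_neg]
    refine intervalIntegral.integral_nonneg_of_ae_restrict ht.1 ?_
    rw [← restrict_Ioc_eq_restrict_Icc]
    refine ae_restrict_of_ae_restrict_of_subset (Ioc_subset_Ioc_right ht.2) ?_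
    filter_upwards [hK, ae_restrict_of_ae hk1.ae_hasDerivAt_integral,
      ae_restrict_of_ae hk2.ae_hasDerivAt_integral, ae_restrict_mem measurableSet_Ioc,
      ae_integrable_flux_slice h.flux h.lt.le] with s hs d1 d2 hsm hKi
    have hsI := Ioc_subset_Icc_self hsm
    have hsu : s ∈ uIcc 0 T := by rw [uIcc_of_le hT.le]; exact hsI
    have e1 := (d1 hsu 0 h0m).const_sub (∫ x in α..β, ρ 0 x * x)
    have e2 := (d2 hsu 0 h0m).const_sub (∫ x in α..β, ρ 0 x * x ^ 2)
    have e3 := e2.sub ((e1.mul e1).const_mul M⁻¹)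
    have hm1 : ∫ x in α..β, ρ s x * x = n₁ s := h.firstMoment_eq hsI
    have hp := hs (n₁ s / M) (by rw [hm1]; field_simp)
    have hexp : ∫ x in α..β, K s x * (x - n₁ s / M) =
        (∫ x in α..β, K s x * (2 * x)) / 2 - n₁ s / M * ∫ x in α..β, K s x := by
      have i1 : IntervalIntegrable (fun x => K s x * (2 * x)) volume α β :=
        hKi.mul_continuousOn (by fun_prop)
      rw [div_eq_mul_inv _ (2 : ℝ), ← intervalIntegral.integral_mul_const,
        ← intervalIntegral.integral_const_mul,
        ← intervalIntegral.integral_sub (i1.mul_const _) (hKi.const_mul _)]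
      refine intervalIntegral.integral_congr fun x _ => ?_
      ring
    have hd : deriv (fun s => n₂ s - M⁻¹ * (n₁ s * n₁ s)) s = _ := e3.deriv
    rw [hd]
    rw [hexp] at hp
    have e4 : M⁻¹ * (-(∫ x in α..β, K s x) * n₁ s + n₁ s * -∫ x in α..β, K s x) =
      -2 * (n₁ s / M * ∫ x in α..β, K s x) := by field_simp; ring
    simp only [hn₁] at e4 hp ⊢
    rw [e4]
    change (0 : ℝ) ≤ _
    linarith
  have hn0 : n₁ 0 = ∫ x in α..β, ρ 0 x * x := by simp [hn₁]
  have hn0' : n₂ 0 = ∫ x in α..β, ρ 0 x * x ^ 2 := by simp [hn₂]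
  have hnt : ∫ x in α..β, ρ t x * x = n₁ t := h.firstMoment_eq ht
  have hnt' : ∫ x in α..β, ρ t x * x ^ 2 = n₂ t := hm2 t ht
  rw [← hn0, ← hn0', hnt, hnt']
  have e : ∀ s, n₂ s - n₁ s ^ 2 / M = n₂ s - M⁻¹ * (n₁ s * n₁ s) := fun s => by field_simp
  rw [e, e]
  linarith

end Variance

/-! ### One-dimensional functions with an integrable weak derivative -/

section Sobolev

theorem exists_Icc_subset_of_isCompact {a b : ℝ} {S : Set ℝ} (hS : IsCompact S) (hne : S.Nonempty)
    (hsub : S ⊆ Ioo a b) : ∃ l r, a < l ∧ r < b ∧ S ⊆ Icc l r := by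
  obtain ⟨l, hl, hl'⟩ := hS.exists_isLeast hne
  obtain ⟨r, hr, hr'⟩ := hS.exists_isGreatest hne
  exact ⟨l, r, (hsub hl).1, (hsub hr).2, fun x hx => ⟨hl' hx, hr' hx⟩⟩

/-- The primitive of a test function of zero mean is a test function. -/
theorem isTestFunction_primitive {a b l r : ℝ} {g : ℝ → ℝ} (hg : ContDiff ℝ ∞ g) (hal : a < l)
    (hrb : r < b) (hsupp : ∀ x ∉ Icc l r, g x = 0) (hint : ∫ x in a..b, g x = 0) :
    IsTestFunction a b (fun x => ∫ y in a..x, g y) ∧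
      deriv (fun x => ∫ y in a..x, g y) = g := by
  have hgc : Continuous g := hg.continuous
  have hd : ∀ x, HasDerivAt (fun x => ∫ y in a..x, g y) (g x) x := fun x =>
    intervalIntegral.integral_hasDerivAt_right (hgc.intervalIntegrable _ _)
      (hgc.stronglyMeasurableAtFilter _ _) hgc.continuousAt
  have hdψ : deriv (fun x => ∫ y in a..x, g y) = g := funext fun x => (hd x).deriv
  have hzero : ∀ x ∉ Icc l r, ∫ y in a..x, g y = 0 := by
    intro x hx
    rcases lt_or_ge x l with hxl | hxl
    · have : EqOn g (fun _ => 0) (uIcc a x) := fun y hy => hsupp y fun h => by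
        rw [uIcc, mem_Icc] at hy
        exact absurd h.1 (not_le.2 (hy.2.trans_lt (max_lt hal hxl)))
      rw [intervalIntegral.integral_congr this]
      simp
    · have hxr : r < x := not_le.1 fun h => hx ⟨hxl, h⟩
      have : EqOn g (fun _ => 0) (uIcc x b) := fun y hy => hsupp y fun h => by
        rw [uIcc, mem_Icc] at hy
        exact absurd h.2 (not_le.2 ((lt_min hxr hrb).trans_le hy.1))
      have h2 : ∫ y in x..b, g y = 0 := by
        rw [intervalIntegral.integral_congr this]
        simp
      have := intervalIntegral.integral_add_adjacent_intervals
        (hgc.intervalIntegrable (μ := volume) a x) (hgc.intervalIntegrable (μ := volume) x b)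
      linarith
  refine ⟨⟨?_, ?_, ?_⟩, hdψ⟩
  · rw [contDiff_infty_iff_deriv]
    exact ⟨fun x => (hd x).differentiableAt, by rw [hdψ]; exact hg⟩
  · exact HasCompactSupport.intro isCompact_Icc hzero
  · refine (closure_minimal (fun x hx => ?_) isClosed_Icc).trans (Icc_subset_Ioo hal hrb)
    by_contra h
    exact hx (hzero x h)

/-- A function with an integrable weak derivative is a.e. equal to a primitive of it. -/
theorem exists_ae_eq_primitive {q dq : ℝ → ℝ} {a b : ℝ} (hab : a < b)
    (hq : IntervalIntegrable q volume a b) (hdq : IntervalIntegrable dq volume a b)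
    (h : ∀ ψ : ℝ → ℝ, IsTestFunction a b ψ →
      ∫ x in a..b, q x * deriv ψ x = -∫ x in a..b, dq x * ψ x) :
    ∃ C, ∀ᵐ x ∂volume.restrict (Ioc a b), q x = C + ∫ y in a..x, dq y := by
  have hDc := (hdq.absolutelyContinuousOnInterval_intervalIntegral (c := a) left_mem_uIcc).continuousOn
  set f : ℝ → ℝ := fun x => q x - ∫ y in a..x, dq y with hf
  have hfi : IntervalIntegrable f volume a b := hq.sub hDc.intervalIntegrable
  set B : ContDiffBump ((a + b) / 2) := ⟨(b - a) / 8, (b - a) / 4, by linarith, by linarith⟩ with hB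
  -- A fixed bump of integral 1: subtracting a multiple of it gives any test function zero mean, so
  -- that its primitive is again a test function.
  set η₀ : ℝ → ℝ := B.normed volume with hη₀
  have h0 : ContDiff ℝ ∞ η₀ := B.contDiff_normed
  have h0s : tsupport η₀ ⊆ Ioo a b := by
    rw [hη₀, B.tsupport_normed_eq, Real.closedBall_eq_Icc]
    refine Icc_subset_Ioo ?_ ?_ <;> simp only [hB] <;> linarith
  have h0c : HasCompactSupport η₀ := B.hasCompactSupport_normed
  have hres : ∀ {g : ℝ → ℝ}, tsupport g ⊆ Ioo a b → ∫ x, g x = ∫ x in a..b, g x := fun hg =>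
    (intervalIntegral.integral_eq_integral_of_support_subset
      ((subset_tsupport _).trans (hg.trans Ioo_subset_Ioc_self))).symm
  have h0i : ∫ x in a..b, η₀ x = 1 := by rw [← hres h0s]; exact B.integral_normed
  set C := ∫ x in a..b, f x * η₀ x with hC
  refine ⟨C, ?_⟩
  have hloc : LocallyIntegrableOn (fun x => f x - C) (Ioo a b) volume :=
    (((intervalIntegrable_iff_integrableOn_Ioc_of_le hab.le).1
      (hfi.sub intervalIntegrable_const)).mono_set Ioo_subset_Ioc_self).locallyIntegrableOn
  have key := isOpen_Ioo.ae_eq_zero_of_integral_contDiff_smul_eq_zero hloc fun η hη hηc hηs => by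
    obtain ⟨l, r, hal, hrb, hlrs⟩ := exists_Icc_subset_of_isCompact
      (hηc.isCompact.union h0c.isCompact) (by
        refine Nonempty.inr ?_
        by_contra hemp
        rw [not_nonempty_iff_eq_empty, tsupport_eq_empty_iff] at hemp
        rw [hemp] at h0i
        simp at h0i) (union_subset hηs h0s)
    set c := ∫ x in a..b, η x with hc
    set g : ℝ → ℝ := fun x => η x - c * η₀ x with hg
    have hgs : ContDiff ℝ ∞ g := hη.sub (contDiff_const.mul h0)
    have hgi : ∫ x in a..b, g x = 0 := by
      simp only [hg]
      rw [intervalIntegral.integral_sub (hη.continuous.intervalIntegrable _ _)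
        ((h0.continuous.intervalIntegrable _ _).const_mul _),
        intervalIntegral.integral_const_mul, h0i]
      simp [hc]
    obtain ⟨ht, hdt⟩ := isTestFunction_primitive hgs hal hrb (fun x hx => by
      have h1 : η x = 0 := image_eq_zero_of_notMem_tsupport fun h => hx (hlrs (Or.inl h))
      have h2 : η₀ x = 0 := image_eq_zero_of_notMem_tsupport fun h => hx (hlrs (Or.inr h))
      simp [hg, h1, h2]) hgi
    have hw := h _ ht
    rw [hdt] at hw
    have hp := integral_mul_primitive_add hdq (hgs.continuous.intervalIntegrable a b)
    rw [hgi, mul_zero] at hp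
    have hfg : ∫ x in a..b, f x * g x = 0 := by
      simp only [hf, sub_mul]
      rw [intervalIntegral.integral_sub (hq.mul_continuousOn hgs.continuous.continuousOn)
        ((hDc.intervalIntegrable (μ := volume)).mul_continuousOn hgs.continuous.continuousOn)]
      linarith
    have i1 : IntervalIntegrable (fun x => f x * η x) volume a b :=
      hfi.mul_continuousOn hη.continuous.continuousOn
    have i2 : IntervalIntegrable (fun x => f x * η₀ x) volume a b :=
      hfi.mul_continuousOn h0.continuous.continuousOn
    have hfg2 : (∫ x in a..b, f x * η x) - c * C = 0 := by
      rw [← hfg, hC, ← intervalIntegral.integral_const_mul,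
        ← intervalIntegral.integral_sub i1 (i2.const_mul c)]
      refine intervalIntegral.integral_congr fun x _ => ?_
      simp only [hg]
      ring
    rw [← intervalIntegral.integral_eq_integral_of_support_subset (a := a) (b := b) (fun x hx => by
      refine Ioo_subset_Ioc_self (hηs (subset_tsupport η ?_))
      intro h0
      simp [h0] at hx)]
    simp only [smul_eq_mul, mul_sub]
    rw [intervalIntegral.integral_sub (by simpa only [mul_comm] using i1)
      ((hη.continuous.intervalIntegrable _ _).mul_const _), intervalIntegral.integral_mul_const,
      ← hfg2]
    simp only [mul_comm (η _)]
    rfl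
  rw [← restrict_Ioo_eq_restrict_Ioc, ae_restrict_iff' measurableSet_Ioo]
  filter_upwards [key] with x hx hxm
  have := hx hxm
  simp only [hf] at this
  linarith

end Sobolev

/-! ### The pressure at a fixed time -/

section Slice

/-- A pressure profile `P` with derivative `dp` at a fixed time: it is nonnegative and vanishes
where the two densities do not add up to `1`. -/
structure IsPressureSlice (α β : ℝ) (dp ρ₁ ρ₂ P : ℝ → ℝ) : Prop where
  lt : α < β
  integrable : IntervalIntegrable dp volume α β
  eq_primitive : ∀ x ∈ Icc α β, P x = P α + ∫ y in α..x, dp y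
  nonneg : ∀ x ∈ Icc α β, 0 ≤ P x
  compl : ∀ᵐ x ∂volume.restrict (Ioc α β), P x * (1 - ρ₁ x - ρ₂ x) = 0

variable {α β : ℝ} {dp ρ₁ ρ₂ P Φ : ℝ → ℝ}

theorem IsPressureSlice.symm (h : IsPressureSlice α β dp ρ₁ ρ₂ P) :
    IsPressureSlice α β dp ρ₂ ρ₁ P :=
  ⟨h.lt, h.integrable, h.eq_primitive, h.nonneg, by
    simpa only [sub_right_comm] using h.compl⟩

theorem IsPressureSlice.continuousOn (h : IsPressureSlice α β dp ρ₁ ρ₂ P) :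
    ContinuousOn P (Icc α β) := by
  have := (h.integrable.absolutelyContinuousOnInterval_intervalIntegral (c := α)
    left_mem_uIcc).continuousOn
  rw [uIcc_of_le h.lt.le] at this
  exact (continuousOn_const.add this).congr h.eq_primitive

theorem IsPotential.hasDerivAt (hΦ : IsPotential α β Φ) {x : ℝ} (hx : x ∈ Ioo α β) :
    HasDerivAt Φ (deriv Φ x) x :=
  ((hΦ.contDiffOn.differentiableOn (by simp)).differentiableAt (isOpen_Ioo.mem_nhds hx)).hasDerivAt

theorem IsPotential.continuousOn_deriv (hΦ : IsPotential α β Φ) :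
    ContinuousOn (deriv Φ) (Ioo α β) :=
  hΦ.contDiffOn.continuousOn_deriv_of_isOpen isOpen_Ioo le_rfl

theorem IsPotential.intervalIntegrable_deriv (hΦ : IsPotential α β Φ) (hαβ : α ≤ β) :
    IntervalIntegrable (deriv Φ) volume α β := by
  obtain ⟨C, hC⟩ := hΦ.bounded_deriv
  rw [intervalIntegrable_iff_integrableOn_Ioc_of_le hαβ, IntegrableOn,
    ← restrict_Ioo_eq_restrict_Ioc]
  exact Integrable.of_bound (measurable_deriv Φ).aestronglyMeasurable C
    ((ae_restrict_mem measurableSet_Ioo).mono fun x hx => hC x hx)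

theorem IsPressureSlice.continuousOn_add (h : IsPressureSlice α β dp ρ₁ ρ₂ P)
    (hΦ : IsPotential α β Φ) : ContinuousOn (fun x => P x + Φ x) (Ioo α β) :=
  (h.continuousOn.mono Ioo_subset_Icc_self).add hΦ.contDiffOn.continuousOn

theorem IsPressureSlice.integral_eq_sub (h : IsPressureSlice α β dp ρ₁ ρ₂ P)
    (hΦ : IsPotential α β Φ) {x y : ℝ} (hx : α < x) (hxy : x ≤ y) (hy : y < β) :
    ∫ z in x..y, (dp z + deriv Φ z) = (P y + Φ y) - (P x + Φ x) := by
  have hsub : ∀ u v, α ≤ u → u ≤ v → v ≤ β → IntervalIntegrable dp volume u v :=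
    fun u v h1 h2 h3 => h.integrable.mono_set (by
      rw [uIcc_of_le h2, uIcc_of_le h.lt.le]; exact Icc_subset_Icc h1 h3)
  have hI : uIcc x y ⊆ Ioo α β := by
    rw [uIcc_of_le hxy]; exact Icc_subset_Ioo hx hy
  have hΦi : IntervalIntegrable (deriv Φ) volume x y :=
    (hΦ.continuousOn_deriv.mono hI).intervalIntegrable
  rw [intervalIntegral.integral_add (hsub x y hx.le hxy hy.le) hΦi,
    intervalIntegral.integral_eq_sub_of_hasDerivAt (fun z hz => hΦ.hasDerivAt (hI hz)) hΦi,
    h.eq_primitive x ⟨hx.le, hxy.trans hy.le⟩, h.eq_primitive y ⟨hx.le.trans hxy, hy.le⟩,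
    ← intervalIntegral.integral_interval_sub_left (hsub α y le_rfl (hx.le.trans hxy) hy.le)
      (hsub α x le_rfl hx.le (hxy.trans hy.le))]
  ring

theorem IsPressureSlice.ae_hasDerivAt (h : IsPressureSlice α β dp ρ₁ ρ₂ P)
    (hΦ : IsPotential α β Φ) :
    ∀ᵐ x, x ∈ Ioo α β → HasDerivAt (fun x => P x + Φ x) (dp x + deriv Φ x) x := by
  filter_upwards [h.integrable.ae_hasDerivAt_integral] with x hx hxm
  rw [uIcc_of_le h.lt.le] at hx
  have h1 := (hx (Ioo_subset_Icc_self hxm) α ⟨le_rfl, h.lt.le⟩).const_add (P α)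
  have h2 : HasDerivAt P (dp x) x := h1.congr_of_eventuallyEq (by
    filter_upwards [isOpen_Ioo.mem_nhds hxm] with y hy
    exact h.eq_primitive y (Ioo_subset_Icc_self hy))
  exact h2.add (hΦ.hasDerivAt hxm)

/-- The flux `(dp + Φ') ρ` is balanced on the intervals where the density is saturated. -/
def FluxBalanced (α β : ℝ) (dp Φ ρ : ℝ → ℝ) : Prop :=
  ∀ c δ : ℚ, (0 : ℝ) < δ → α ≤ c - δ → c + δ ≤ β →
    (∀ᵐ x ∂volume.restrict (Ioc (c - δ : ℝ) (c + δ)), ρ x = 1) →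
    ∫ x in (c - δ : ℝ)..c, (dp x + deriv Φ x) * ρ x =
      ∫ x in (c : ℝ)..(c + δ), (dp x + deriv Φ x) * ρ x

/-- Where `ρ₁ = 1` the flux is `dp + Φ'`, whose integrals are increments of `P + Φ`. Equal integrals
over the two halves of an interval are the midpoint identity. -/
theorem IsPressureSlice.midpoint (h : IsPressureSlice α β dp ρ₁ ρ₂ P) (hΦ : IsPotential α β Φ)
    (hb : FluxBalanced α β dp Φ ρ₁) {l r : ℝ} (hl : α ≤ l) (hr : r ≤ β)
    (hone : ∀ᵐ x, x ∈ Ioo l r → ρ₁ x = 1) {c δ : ℝ} (hδ : 0 < δ) (hlc : l < c - δ)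
    (hcr : c + δ < r) :
    2 * (P c + Φ c) = (P (c - δ) + Φ (c - δ)) + (P (c + δ) + Φ (c + δ)) := by
  refine midpoint_of_rat (V := fun x => P x + Φ x)
    ((h.continuousOn_add hΦ).mono (Ioo_subset_Ioo hl hr)) ?_ hδ hlc hcr
  intro c δ hδ hlc hcr
  have hone' : ∀ᵐ x ∂volume.restrict (Ioc (c - δ : ℝ) (c + δ)), ρ₁ x = 1 := by
    rw [ae_restrict_iff' measurableSet_Ioc]
    filter_upwards [hone] with x hx hxm
    exact hx ⟨hlc.trans hxm.1, hxm.2.trans_lt hcr⟩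
  have hbal := hb c δ hδ (hl.trans hlc.le) (hcr.le.trans hr) hone'
  have e : ∀ u v : ℝ, c - δ ≤ u → u ≤ v → v ≤ c + δ →
      ∫ x in u..v, (dp x + deriv Φ x) * ρ₁ x = (P v + Φ v) - (P u + Φ u) := by
    intro u v h1 h2 h3
    rw [← h.integral_eq_sub hΦ (hl.trans_lt (hlc.trans_le h1)) h2 ((h3.trans_lt hcr).trans_le hr)]
    refine intervalIntegral.integral_congr_ae ((ae_restrict_iff' measurableSet_uIoc).1 ?_)
    rw [uIoc_of_le h2]
    filter_upwards [ae_restrict_of_ae_restrict_of_subset (Ioc_subset_Ioc h1 h3) hone'] with x hx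
    rw [hx, mul_one]
  rw [e _ _ le_rfl (by linarith) (by linarith), e _ _ (by linarith) (by linarith) le_rfl] at hbal
  linarith

/-- Pressure plus potential is convex wherever only one species is present. -/
theorem IsPressureSlice.convexOn (h : IsPressureSlice α β dp ρ₁ ρ₂ P) (hΦ : IsPotential α β Φ)
    (hΦc : ConvexOn ℝ (Ioo α β) Φ) (hb : FluxBalanced α β dp Φ ρ₁) {l r : ℝ} (hl : α ≤ l)
    (hr : r ≤ β) (hzero : ∀ᵐ x, x ∈ Ioo l r → ρ₂ x = 0) :
    ConvexOn ℝ (Ioo l r) (fun x => P x + Φ x) := by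
  have hsub : Ioo l r ⊆ Ioo α β := Ioo_subset_Ioo hl hr
  refine convexOn_of_touching_or_midpoint ((h.continuousOn_add hΦ).mono hsub) fun z hz => ?_
  have hzI := hsub hz
  -- Where `P` vanishes, `Φ` touches `P + Φ` from below. Where `P > 0`, complementarity and the
  -- absence of `ρ₂` give `ρ₁ = 1` on a neighborhood.
  rcases (h.nonneg z (Ioo_subset_Icc_self hzI)).eq_or_lt with h0 | hpos
  · refine Or.inl ⟨Φ, hΦc.subset hsub (convex_Ioo l r), fun x hx => ?_, by simp [← h0]⟩
    have := h.nonneg x (Ioo_subset_Icc_self (hsub hx))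
    linarith
  · right
    have hcont : ContinuousAt P z := h.continuousOn.continuousAt (Icc_mem_nhds hzI.1 hzI.2)
    have hev : ∀ᶠ x in 𝓝 z, 0 < P x ∧ x ∈ Ioo l r :=
      (hcont.eventually (lt_mem_nhds hpos)).and (isOpen_Ioo.mem_nhds hz)
    obtain ⟨ε, hε, hball⟩ := Metric.eventually_nhds_iff_ball.1 hev
    rw [Real.ball_eq_Ioo] at hball
    have hone : ∀ᵐ x, x ∈ Ioo (z - ε) (z + ε) → ρ₁ x = 1 := by
      filter_upwards [(ae_restrict_iff' measurableSet_Ioc).1 h.compl, hzero] with x h1 h2 hx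
      obtain ⟨hPx, hxm⟩ := hball x hx
      have := (mul_eq_zero.1 (h1 (Ioo_subset_Ioc_self (hsub hxm)))).resolve_left hPx.ne'
      rw [h2 hxm] at this
      linarith
    have hsub2 : Ioo (z - ε) (z + ε) ⊆ Ioo α β := fun x hx => hsub (hball x hx).2
    obtain ⟨h1, h2⟩ := (Ioo_subset_Ioo_iff (by linarith)).1 hsub2
    filter_upwards [Ioo_mem_nhdsGT hε] with δ hδ
    exact (h.midpoint hΦ hb h1 h2 hone hδ.1 (by linarith [hδ.2]) (by linarith [hδ.2])).le

/-- Inside a patch, pressure plus potential is affine. -/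
theorem IsPressureSlice.affine (h : IsPressureSlice α β dp ρ₁ ρ₂ P) (hΦ : IsPotential α β Φ)
    (hb : FluxBalanced α β dp Φ ρ₁) {l r : ℝ} (hl : α ≤ l) (hlr : l < r) (hr : r ≤ β)
    (hone : ∀ᵐ x, x ∈ Ioo l r → ρ₁ x = 1) :
    ∃ w e : ℝ, ∀ x ∈ Ioo l r, P x + Φ x = w * x + e :=
  affine_of_midpoint (V := fun x => P x + Φ x) hlr
    ((h.continuousOn_add hΦ).mono (Ioo_subset_Ioo hl hr))
    fun _ _ hδ h1 h2 => h.midpoint hΦ hb hl hr hone hδ h1 h2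

end Slice

/-! ### From weak solutions to flows and pressure slices -/

section Bridge

/-- Passing from almost every slice to the product measure needs a measurable set, hence the detour
through a measurable representative. -/
theorem ae_prod_nonneg {X Y : Type*} [MeasurableSpace X] [MeasurableSpace Y] {μ : Measure X}
    {ν : Measure Y} [SFinite μ] [SFinite ν] {f : X → Y → ℝ}
    (hf : AEStronglyMeasurable (Function.uncurry f) (μ.prod ν))
    (h : ∀ᵐ x ∂μ, ∀ᵐ y ∂ν, 0 ≤ f x y) : ∀ᵐ z ∂μ.prod ν, 0 ≤ f z.1 z.2 := by
  have hm : MeasurableSet {z | 0 ≤ hf.mk _ z} :=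
    measurableSet_le measurable_const hf.stronglyMeasurable_mk.measurable
  have h1 : ∀ᵐ z ∂μ.prod ν, 0 ≤ hf.mk _ z := by
    refine (Measure.ae_prod_mem_iff_ae_ae_mem hm).2 ?_
    filter_upwards [h, Measure.ae_ae_of_ae_prod hf.ae_eq_mk] with x hx hx2
    filter_upwards [hx, hx2] with y hy hy2
    show 0 ≤ hf.mk _ (x, y)
    rw [← hy2]
    exact hy
  filter_upwards [h1, hf.ae_eq_mk] with z hz hz2
  rw [← hz2] at hz
  exact hz

variable {T α β M M₁ M₂ : ℝ} {Φ Φ₁ Φ₂ ρ₁₀ ρ₂₀ : ℝ → ℝ} {ρ ρ₁ ρ₂ p dp : ℝ → ℝ → ℝ}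

/-- Time-independent test functions suffice. The flux is integrable because `dp` is square
integrable on a bounded set, `Φ'` is bounded and `0 ≤ ρ ≤ 1`. -/
theorem isFlow_of_solvesTransport (hαβ : α < β) (hΦ : IsPotential α β Φ)
    (hac : IsAC2Curve T α β M ρ)
    (hm : AEStronglyMeasurable (Function.uncurry ρ)
      ((volume.restrict (Icc 0 T)).prod (volume.restrict (Ioo α β))))
    (h1 : ∀ᵐ z ∂((volume.restrict (Icc 0 T)).prod (volume.restrict (Ioo α β))), ρ z.1 z.2 ≤ 1)
    (hp : IsL2H1 T α β p dp) (hs : SolvesTransport T α β Φ dp ρ) :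
    IsFlow T α β M ρ (fun τ x => (dp τ x + deriv Φ x) * ρ τ x) where
  lt := hαβ
  integrable t ht := by
    rw [intervalIntegrable_iff_integrableOn_Ioc_of_le hαβ.le, integrableOn_Ioc_iff_integrableOn_Ioo]
    exact hac.integrable t ht
  nonneg t ht := by
    rw [← restrict_Ioo_eq_restrict_Ioc]
    exact hac.nonneg t ht
  mass t ht := by
    rw [intervalIntegral.integral_of_le hαβ.le, integral_Ioc_eq_integral_Ioo]
    exact hac.mass t ht
  ae_le_one := by
    rw [← restrict_Ioo_eq_restrict_Ioc (a := α), restrict_Ioc_eq_restrict_Icc]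
    exact Measure.ae_ae_of_ae_prod h1
  flux := by
    obtain ⟨C, hC⟩ := hΦ.bounded_deriv
    have h0 := ae_prod_nonneg hm
      ((ae_restrict_mem measurableSet_Icc).mono fun t ht => hac.nonneg t ht)
    have i1 : Integrable (Function.uncurry dp)
        ((volume.restrict (Icc 0 T)).prod (volume.restrict (Ioo α β))) :=
      hp.memLp_deriv.integrable one_le_two
    have i2 : Integrable (deriv Φ) (volume.restrict (Ioo α β)) :=
      Integrable.of_bound (measurable_deriv Φ).aestronglyMeasurable C
        ((ae_restrict_mem measurableSet_Ioo).mono fun x hx => hC x hx)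
    have i3 := (i1.add (i2.comp_snd (volume.restrict (Icc 0 T)))).mul_bdd (c := 1) hm (by
      filter_upwards [h0, h1] with z hz0 hz1
      rw [Real.norm_eq_abs, Function.uncurry, abs_of_nonneg hz0]
      exact hz1)
    rw [IntegrableOn, Measure.volume_eq_prod, ← Measure.prod_restrict, restrict_Ioc_eq_restrict_Icc,
      ← restrict_Ioo_eq_restrict_Ioc]
    exact i3
  weak ψ hψ s t h0s hst htT := by
    rcases hst.eq_or_lt with rfl | hlt
    · simp
    have h := hs (fun _ x => ψ x) (hψ.comp contDiff_snd) s t h0s hlt htT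
    simp only [deriv_const, mul_zero, integral_zero, intervalIntegral.integral_zero, neg_zero,
      zero_add] at h
    simp_rw [intervalIntegral.integral_of_le hαβ.le, integral_Ioc_eq_integral_Ioo]
    rw [← h]
    simp_rw [mul_right_comm]

/-- The representative is the primitive of `dp t`. Its continuity upgrades nonnegativity from almost
every point to every point. -/
theorem IsWeakSolution.ae_slice (hαβ : α < β)
    (hsol : IsWeakSolution T α β M₁ M₂ Φ₁ Φ₂ ρ₁₀ ρ₂₀ ρ₁ ρ₂ p) (hp : IsL2H1 T α β p dp) :
    ∀ᵐ t ∂volume.restrict (Ioc 0 T), ∃ P : ℝ → ℝ, p t =ᵐ[volume.restrict (Ioc α β)] P ∧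
      IsPressureSlice α β (dp t) (ρ₁ t) (ρ₂ t) P := by
  rw [restrict_Ioc_eq_restrict_Icc (a := (0 : ℝ))]
  have i1 : Integrable (Function.uncurry p)
      ((volume.restrict (Icc 0 T)).prod (volume.restrict (Ioo α β))) :=
    hp.memLp.integrable one_le_two
  have i2 : Integrable (Function.uncurry dp)
      ((volume.restrict (Icc 0 T)).prod (volume.restrict (Ioo α β))) :=
    hp.memLp_deriv.integrable one_le_two
  filter_upwards [hp.weakDeriv, i1.prod_right_ae, i2.prod_right_ae,
    Measure.ae_ae_of_ae_prod hsol.pressure_nonneg, Measure.ae_ae_of_ae_prod hsol.complementarity]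
    with t hw hpi hdi hnn hcompl
  have hpi' : IntervalIntegrable (p t) volume α β := by
    rw [intervalIntegrable_iff_integrableOn_Ioc_of_le hαβ.le, integrableOn_Ioc_iff_integrableOn_Ioo]
    exact hpi
  have hdi' : IntervalIntegrable (dp t) volume α β := by
    rw [intervalIntegrable_iff_integrableOn_Ioc_of_le hαβ.le, integrableOn_Ioc_iff_integrableOn_Ioo]
    exact hdi
  obtain ⟨C, hC⟩ := exists_ae_eq_primitive hαβ hpi' hdi' fun ψ hψ => by
    simp_rw [intervalIntegral.integral_of_le hαβ.le, integral_Ioc_eq_integral_Ioo]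
    exact hw ψ hψ
  have hcont : ContinuousOn (fun x => C + ∫ y in α..x, dp t y) (Icc α β) := by
    have := (hdi'.absolutelyContinuousOnInterval_intervalIntegral (c := α)
      left_mem_uIcc).continuousOn
    rw [uIcc_of_le hαβ.le] at this
    exact continuousOn_const.add this
  rw [restrict_Ioo_eq_restrict_Ioc] at hnn hcompl
  refine ⟨fun x => C + ∫ y in α..x, dp t y, hC, hαβ, hdi', by simp, fun x hx => ?_, ?_⟩
  · have := le_on_Icc_of_ae_le (c := 0) hαβ hcont.neg (by
      filter_upwards [hnn, hC] with y hy hy2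
      simp only [Pi.neg_apply] at *
      linarith) hx
    simp only [Pi.neg_apply] at this
    linarith
  · filter_upwards [hcompl, hC] with y hy hy2
    rw [← hy2]
    exact hy

end Bridge

/-! ### Persistence of patches -/

section Patches

variable {T α β M : ℝ} {ρ K : ℝ → ℝ → ℝ}

/-- The barycenter of the density `ρ t` of mass `M`, written as a primitive in time. -/
def barycenter (α β M : ℝ) (ρ K : ℝ → ℝ → ℝ) (t : ℝ) : ℝ :=
  M⁻¹ * ((∫ x in α..β, ρ 0 x * x) - ∫ τ in 0..t, ∫ x in α..β, K τ x)

theorem IsFlow.moment_eq_barycenter (h : IsFlow T α β M ρ K) (hM : 0 < M) {t : ℝ}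
    (ht : t ∈ Icc 0 T) : ∫ x in α..β, ρ t x * x = M * barycenter α β M ρ K t := by
  rw [h.firstMoment_eq ht, barycenter]
  field_simp

theorem IsFlow.absolutelyContinuous_barycenter (h : IsFlow T α β M ρ K) (hT : 0 ≤ T) (r : ℝ) :
    AbsolutelyContinuousOnInterval (fun t => barycenter α β M ρ K t + r) 0 T := by
  have hconst : ∀ c : ℝ, AbsolutelyContinuousOnInterval (fun _ : ℝ => c) 0 T := fun c =>
    contDiffOn_const.absolutelyContinuousOnInterval
  exact (((hconst _).sub ((h.intervalIntegrable_firstMoment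
    hT).absolutelyContinuousOnInterval_intervalIntegral left_mem_uIcc)).const_mul M⁻¹).add (hconst r)

theorem IsFlow.ae_hasDerivAt_barycenter (h : IsFlow T α β M ρ K) (hT : 0 ≤ T) :
    ∀ᵐ t ∂volume.restrict (Ioo 0 T), HasDerivAt (barycenter α β M ρ K)
      (M⁻¹ * -∫ x in α..β, K t x) t := by
  rw [ae_restrict_iff' measurableSet_Ioo]
  filter_upwards [(h.intervalIntegrable_firstMoment hT).ae_hasDerivAt_integral] with t ht htm
  rw [uIcc_of_le hT] at ht
  exact ((ht (Ioo_subset_Icc_self htm) 0 ⟨le_rfl, hT⟩).const_sub _).const_mul _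

theorem integral_indicator_Ioo_mul {a b c d : ℝ} (hcd : c ≤ d) (hac : a ≤ c) (hdb : d ≤ b)
    {f : ℝ → ℝ} (hf : f =ᵐ[volume.restrict (Ioc a b)] (Ioo c d).indicator 1) (g : ℝ → ℝ) :
    ∫ x in a..b, f x * g x = ∫ x in c..d, g x := by
  rw [intervalIntegral.integral_of_le (hac.trans (hcd.trans hdb)),
    intervalIntegral.integral_of_le hcd, integral_Ioc_eq_integral_Ioo (x := c)]
  have : ∫ x in Ioc a b, f x * g x = ∫ x in Ioc a b, (Ioo c d).indicator g x := by
    refine integral_congr_ae ?_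
    filter_upwards [hf] with x hx
    rw [hx]
    by_cases hxm : x ∈ Ioo c d <;> simp [hxm]
  rw [this, setIntegral_indicator measurableSet_Ioo, inter_eq_self_of_subset_right]
  exact fun x hx => ⟨hac.trans_lt hx.1, hx.2.le.trans hdb⟩

/-- The initial patch has variance `M ^ 3 / 12`, the least possible, and the variance does not
increase. The equality case identifies the density at every time. -/
theorem IsFlow.eq_patch (h : IsFlow T α β M ρ K) (hT : 0 < T) {c d : ℝ} (hcd : c < d)
    (hsub : Ioo c d ⊆ Ioo α β)
    (h0 : ρ 0 =ᵐ[volume.restrict (Ioc α β)] (Ioo c d).indicator 1) (hM : M = d - c)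
    (hK : ∀ᵐ t ∂volume.restrict (Ioc 0 T), ∀ m, ∫ x in α..β, ρ t x * x = M * m →
      0 ≤ ∫ x in α..β, K t x * (x - m)) {t : ℝ} (ht : t ∈ Icc 0 T) :
    α ≤ barycenter α β M ρ K t - M / 2 ∧ barycenter α β M ρ K t + M / 2 ≤ β ∧
      ρ t =ᵐ[volume.restrict (Ioc α β)]
        (Ioo (barycenter α β M ρ K t - M / 2) (barycenter α β M ρ K t + M / 2)).indicator 1 := by
  have hMpos : 0 < M := by rw [hM]; linarith
  obtain ⟨hac, hdb⟩ := (Ioo_subset_Ioo_iff hcd).1 hsub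
  have hm := h.moment_eq_barycenter hMpos ht
  refine eq_indicator_of_second_moment_le h.lt (h.integrable t ht) (h.nonneg t ht)
    (h.le_one hT ht) hMpos (h.mass t ht) ?_
  rw [second_moment_center (h.integrable t ht) (h.mass t ht) hm]
  have hv := h.variance_le hT hMpos hK ht
  have e1 : ∫ x in α..β, ρ 0 x * x = (d ^ 2 - c ^ 2) / 2 := by
    rw [integral_indicator_Ioo_mul hcd.le hac hdb h0 fun x => x, integral_id]
  have e2 : ∫ x in α..β, ρ 0 x * x ^ 2 = (d ^ 3 - c ^ 3) / 3 := by
    rw [integral_indicator_Ioo_mul hcd.le hac hdb h0 fun x => x ^ 2, integral_pow]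
    norm_num
  rw [hm, e1, e2] at hv
  have e3 : (M * barycenter α β M ρ K t) ^ 2 / M = M * barycenter α β M ρ K t ^ 2 := by field_simp
  have e4 : (d ^ 3 - c ^ 3) / 3 - ((d ^ 2 - c ^ 2) / 2) ^ 2 / M = M ^ 3 / 12 := by
    rw [hM]
    have : d - c ≠ 0 := by linarith
    field_simp
    ring
  rw [e3, e4] at hv
  exact hv

theorem ae_eq_zero_of_integral_eq_zero {f : ℝ → ℝ} {a b u v : ℝ} (hau : a ≤ u) (huv : u ≤ v)
    (hvb : v ≤ b) (hf : IntervalIntegrable f volume a b)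
    (h0 : ∀ᵐ x ∂volume.restrict (Ioc a b), 0 ≤ f x) (hint : ∫ x in u..v, f x = 0) :
    ∀ᵐ x, x ∈ Ioc u v → f x = 0 := by
  have h0' := ae_restrict_of_ae_restrict_of_subset (Ioc_subset_Ioc hau hvb) h0
  have hfi : IntervalIntegrable f volume u v := hf.mono_set (by
    rw [uIcc_of_le huv, uIcc_of_le (hau.trans (huv.trans hvb))]; exact Icc_subset_Icc hau hvb)
  rw [← ae_restrict_iff' measurableSet_Ioc]
  exact (intervalIntegral.integral_eq_zero_iff_of_le_of_nonneg_ae huv h0' hfi).1 hint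

theorem exists_mem_Ioo_of_ae {Q : ℝ → Prop} {u v : ℝ} (huv : u < v)
    (h : ∀ᵐ x, x ∈ Ioo u v → Q x) : ∃ x ∈ Ioo u v, Q x := by
  by_contra! hcon
  have : volume (Ioo u v) = 0 := by
    refine measure_mono_null (fun x hx => ?_) h
    simp only [mem_compl_iff, mem_ofPred_eq]
    exact fun hq => hcon x hx (hq hx)
  rw [Real.volume_Ioo, ENNReal.ofReal_eq_zero] at this
  linarith

/-- A patch does not meet an interval on which its density vanishes. -/
theorem disjoint_of_ae_zero {f : ℝ → ℝ} {a b c d u v : ℝ} (hac : a ≤ c) (hdb : d ≤ b)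
    (hf : f =ᵐ[volume.restrict (Ioc a b)] (Ioo c d).indicator 1)
    (h0 : ∀ᵐ x, x ∈ Ioc u v → f x = 0) : min d v ≤ max c u := by
  by_contra! hcon
  obtain ⟨x, hx, h1⟩ := exists_mem_Ioo_of_ae (Q := fun _ => False) hcon (by
    filter_upwards [(ae_restrict_iff' measurableSet_Ioc).1 hf, h0] with x hx hx0 hxm
    have hcd : x ∈ Ioo c d :=
      ⟨(le_max_left _ _).trans_lt hxm.1, hxm.2.trans_le (min_le_left _ _)⟩
    have huv : x ∈ Ioc u v :=
      ⟨(le_max_right _ _).trans_lt hxm.1, hxm.2.le.trans (min_le_right _ _)⟩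
    have := hx ⟨hac.trans_lt hcd.1, hcd.2.le.trans hdb⟩
    rw [indicator_of_mem hcd, hx0 huv] at this
    simp at this)
  exact h1

end Patches

/-! ### Consequences of convex or affine pressure plus potential -/

section Contraction

variable {α β M l r : ℝ} {dp ρ₁ ρ₂ P Φ : ℝ → ℝ}

theorem IsPressureSlice.contraction (h : IsPressureSlice α β dp ρ₁ ρ₂ P)
    (hΦ : IsPotential α β Φ) (hΦc : ConvexOn ℝ (Ioo α β) Φ) (hb : FluxBalanced α β dp Φ ρ₁)
    (hl : α ≤ l) (hr : r ≤ β) (hzero : ∀ᵐ x, x ∈ Ioo l r → ρ₂ x = 0)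
    (hsupp : ∀ᵐ x ∂volume.restrict (Ioc α β), x ∉ Ioo l r → ρ₁ x = 0)
    (hi : IntervalIntegrable ρ₁ volume α β) (h0 : ∀ᵐ x ∂volume.restrict (Ioc α β), 0 ≤ ρ₁ x)
    (hM : 0 < M) (hmass : ∫ x in α..β, ρ₁ x = M)
    (hK : IntervalIntegrable (fun x => (dp x + deriv Φ x) * ρ₁ x) volume α β) {m : ℝ}
    (hm : ∫ x in α..β, ρ₁ x * x = M * m) :
    0 ≤ ∫ x in α..β, ((dp x + deriv Φ x) * ρ₁ x) * (x - m) := by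
  refine integral_sub_barycenter_mul_nonneg h.lt.le hi h0 hM hmass hm hsupp
    (h.convexOn hΦ hΦc hb hl hr hzero) ?_ hK
  filter_upwards [h.ae_hasDerivAt hΦ] with x hx hxm
  exact hx (Ioo_subset_Ioo hl hr hxm)

/-- The flux is `w` inside the patch and zero outside, which links the slope of `P + Φ` to the
velocity of the barycenter. -/
theorem IsPressureSlice.integral_flux (h : IsPressureSlice α β dp ρ₁ ρ₂ P)
    (hΦ : IsPotential α β Φ) (hl : α ≤ l) (hr : r ≤ β) {w e : ℝ}
    (haff : ∀ x ∈ Ioo l r, P x + Φ x = w * x + e)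
    (hpatch : ρ₁ =ᵐ[volume.restrict (Ioc α β)] (Ioo l r).indicator 1)
    (hmass : ∫ x in α..β, ρ₁ x = M) :
    ∫ x in α..β, (dp x + deriv Φ x) * ρ₁ x = w * M := by
  rw [← hmass, ← intervalIntegral.integral_const_mul]
  refine intervalIntegral.integral_congr_ae ((ae_restrict_iff' measurableSet_uIoc).1 ?_)
  rw [uIoc_of_le h.lt.le]
  filter_upwards [hpatch, ae_restrict_of_ae (h.ae_hasDerivAt hΦ)] with x hx hd
  by_cases hxm : x ∈ Ioo l r
  · have h1 := hd (Ioo_subset_Ioo hl hr hxm)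
    have h2 : HasDerivAt (fun x => P x + Φ x) w x := by
      have h3 : HasDerivAt (fun x => w * x + e) w x := by
        simpa using ((hasDerivAt_id x).const_mul w).add_const e
      refine h3.congr_of_eventuallyEq ?_
      filter_upwards [isOpen_Ioo.mem_nhds hxm] with y hy using haff y hy
    rw [h1.unique h2]
  · rw [hx, indicator_of_notMem hxm]
    simp

theorem deriv_add_of_affine (hΦ : IsPotential α β Φ) (hl : α ≤ l) (hr : r ≤ β) {w e : ℝ}
    (haff : ∀ x ∈ Ioo l r, P x + Φ x = w * x + e) {x : ℝ} (hx : x ∈ Ioo l r) :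
    deriv P x = w - deriv Φ x := by
  have h3 : HasDerivAt (fun x => w * x + e) w x := by
    simpa using ((hasDerivAt_id x).const_mul w).add_const e
  refine ((h3.sub (hΦ.hasDerivAt (Ioo_subset_Ioo hl hr hx))).congr_of_eventuallyEq ?_).deriv
  filter_upwards [isOpen_Ioo.mem_nhds hx] with y hy
  simp only [Pi.sub_apply]
  linarith [haff y hy]

/-- Inside the patch `P' = w - Φ'`, and the constant `w` integrates to zero against the derivative
of a test function. -/
theorem pressureEquation_of_affine (hΦ : IsPotential α β Φ) (hl : α ≤ l) (hlr : l < r)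
    (hr : r ≤ β) {w e : ℝ} (haff : ∀ x ∈ Ioo l r, P x + Φ x = w * x + e) :
    PressureEquation Φ P l r := by
  have hsub := Ioo_subset_Ioo hl hr
  constructor
  · have h1 : ContDiffOn ℝ 1 (fun x => w * x + e - Φ x) (Ioo l r) :=
      (ContDiff.contDiffOn (by fun_prop)).sub (hΦ.contDiffOn.mono hsub)
    exact h1.congr fun x hx => by linarith [haff x hx]
  · rintro ψ ⟨hψ, -, hs⟩
    have hψ1 : ContDiff ℝ 1 ψ := hψ.of_le (by exact_mod_cast le_top)
    have hc : Continuous (deriv ψ) := hψ1.continuous_deriv le_rfl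
    have hz : ∫ x in l..r, deriv ψ x = 0 := by
      rw [intervalIntegral.integral_deriv_eq_sub (fun x _ => (hψ1.differentiable one_ne_zero) x)
        (hc.intervalIntegrable _ _), image_eq_zero_of_notMem_tsupport fun h => (hs h).2.false,
        image_eq_zero_of_notMem_tsupport fun h => (hs h).1.false, sub_zero]
    have hi : IntervalIntegrable (fun x => deriv Φ x * deriv ψ x) volume l r :=
      ((hΦ.intervalIntegrable_deriv (hl.trans (hlr.le.trans hr))).mono_set (by
        rw [uIcc_of_le hlr.le, uIcc_of_le (hl.trans (hlr.le.trans hr))]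
        exact Icc_subset_Icc hl hr)).mul_continuousOn hc.continuousOn
    have e1 : ∫ x in Ioo l r, deriv P x * deriv ψ x =
        ∫ x in Ioo l r, (w * deriv ψ x - deriv Φ x * deriv ψ x) := by
      refine setIntegral_congr_fun measurableSet_Ioo fun x hx => ?_
      simp only [deriv_add_of_affine hΦ hl hr haff hx]
      ring
    rw [e1, ← integral_Ioc_eq_integral_Ioo, ← integral_Ioc_eq_integral_Ioo,
      ← intervalIntegral.integral_of_le hlr.le, ← intervalIntegral.integral_of_le hlr.le,
      intervalIntegral.integral_sub ((hc.intervalIntegrable _ _).const_mul w) hi,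
      intervalIntegral.integral_const_mul, hz]
    ring

theorem tendsto_deriv_add_of_affine (hΦ : IsPotential α β Φ) (hl : α ≤ l) (hlr : l < r)
    (hr : r ≤ β) {w e : ℝ} (haff : ∀ x ∈ Ioo l r, P x + Φ x = w * x + e) :
    Tendsto (fun x => deriv P x + deriv Φ x) (𝓝[>] l) (𝓝 w) ∧
      Tendsto (fun x => deriv P x + deriv Φ x) (𝓝[<] r) (𝓝 w) := by
  have heq : ∀ x ∈ Ioo l r, w = deriv P x + deriv Φ x := fun x hx => by
    rw [deriv_add_of_affine hΦ hl hr haff hx]; ring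
  constructor
  · refine tendsto_const_nhds.congr' ?_
    filter_upwards [Ioo_mem_nhdsGT hlr] with x hx using heq x hx
  · refine tendsto_const_nhds.congr' ?_
    filter_upwards [Ioo_mem_nhdsLT hlr] with x hx using heq x hx

end Contraction

/-! ### Laws of motion for one phase -/

section Laws

variable {T α β M : ℝ} {Φ : ℝ → ℝ} {ρ ρ' dp : ℝ → ℝ → ℝ}

theorem IsFlow.ae_fluxBalanced
    (h : IsFlow T α β M ρ (fun τ x => (dp τ x + deriv Φ x) * ρ τ x)) (hT : 0 < T) :
    ∀ᵐ t ∂volume.restrict (Ioo 0 T), FluxBalanced α β (dp t) Φ (ρ t) :=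
  h.ae_flux_balanced hT

/-- If, at every time, the density is supported in an interval that the other species does not
charge, then it contracts towards its barycenter. -/
theorem IsFlow.ae_contraction
    (h : IsFlow T α β M ρ (fun τ x => (dp τ x + deriv Φ x) * ρ τ x)) (hT : 0 < T) (hM : 0 < M)
    (hΦ : IsPotential α β Φ) (hΦc : ConvexOn ℝ (Ioo α β) Φ)
    (hslice : ∀ᵐ t ∂volume.restrict (Ioc 0 T), ∃ P, IsPressureSlice α β (dp t) (ρ t) (ρ' t) P)
    (hsep : ∀ t ∈ Icc 0 T, ∃ l r, α ≤ l ∧ r ≤ β ∧ (∀ᵐ x, x ∈ Ioo l r → ρ' t x = 0) ∧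
      ∀ᵐ x ∂volume.restrict (Ioc α β), x ∉ Ioo l r → ρ t x = 0) :
    ∀ᵐ t ∂volume.restrict (Ioc 0 T), ∀ m, ∫ x in α..β, ρ t x * x = M * m →
      0 ≤ ∫ x in α..β, ((dp t x + deriv Φ x) * ρ t x) * (x - m) := by
  have hb := h.ae_fluxBalanced hT
  rw [restrict_Ioo_eq_restrict_Ioc] at hb
  filter_upwards [hslice, hb, ae_integrable_flux_slice h.flux h.lt.le,
    ae_restrict_mem measurableSet_Ioc] with t ⟨P, hP⟩ hbt hi htm m hm
  have ht := Ioc_subset_Icc_self htm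
  obtain ⟨l, r, hl, hr, hz, hs⟩ := hsep t ht
  exact hP.contraction hΦ hΦc hbt hl hr hz hs (h.integrable t ht) (h.nonneg t ht) hM
    (h.mass t ht) hi hm

/-- The patch has constant length `M`, so both endpoints move with the barycenter, at velocity `-M⁻¹
∫ K = -w`. The exceptional null set of times does not depend on the pressure profile. -/
theorem IsFlow.ae_phase_law
    (h : IsFlow T α β M ρ (fun τ x => (dp τ x + deriv Φ x) * ρ τ x)) (hT : 0 < T) (hM : 0 < M)
    (hΦ : IsPotential α β Φ) {c : ℝ → ℝ}
    (hc : c = barycenter α β M ρ (fun τ x => (dp τ x + deriv Φ x) * ρ τ x))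
    (hpatch : ∀ t ∈ Icc 0 T, α ≤ c t - M / 2 ∧ c t + M / 2 ≤ β ∧
      ρ t =ᵐ[volume.restrict (Ioc α β)] (Ioo (c t - M / 2) (c t + M / 2)).indicator 1) :
    ∀ᵐ t ∂volume.restrict (Ioo 0 T), ∀ (ρ' P : ℝ → ℝ),
      IsPressureSlice α β (dp t) (ρ t) ρ' P → ∃ w, HasDerivAt c (-w) t ∧
        PressureEquation Φ P (c t - M / 2) (c t + M / 2) ∧
        VelocityLaw Φ P (fun s => c s - M / 2) (fun s => c s + M / 2) t ∧
        Tendsto (fun x => deriv P x + deriv Φ x) (𝓝[>] (c t - M / 2)) (𝓝 w) ∧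
        Tendsto (fun x => deriv P x + deriv Φ x) (𝓝[<] (c t + M / 2)) (𝓝 w) := by
  filter_upwards [h.ae_fluxBalanced hT, h.ae_hasDerivAt_barycenter hT.le,
    ae_restrict_mem measurableSet_Ioo] with t hb hd htm ρ' P hP
  have ht := Ioo_subset_Icc_self htm
  obtain ⟨hl, hr, hpt⟩ := hpatch t ht
  have hlr : c t - M / 2 < c t + M / 2 := by linarith
  have hone : ∀ᵐ x, x ∈ Ioo (c t - M / 2) (c t + M / 2) → ρ t x = 1 := by
    filter_upwards [(ae_restrict_iff' measurableSet_Ioc).1 hpt] with x hx hxm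
    rw [hx ⟨hl.trans_lt hxm.1, hxm.2.le.trans hr⟩, indicator_of_mem hxm]
    rfl
  obtain ⟨w, e, haff⟩ := hP.affine hΦ hb hl hlr hr hone
  have hflux := hP.integral_flux hΦ hl hr haff hpt (h.mass t ht)
  rw [hflux, ← hc] at hd
  have hd' : HasDerivAt c (-w) t := by
    convert hd using 1
    field_simp
  obtain ⟨t1, t2⟩ := tendsto_deriv_add_of_affine hΦ hl hlr hr haff
  have hneg : ∀ {F : Filter ℝ}, Tendsto (fun x => deriv P x + deriv Φ x) F (𝓝 w) →
      Tendsto (fun x => -deriv P x - deriv Φ x) F (𝓝 (-w)) := fun hF =>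
    hF.neg.congr fun x => by ring
  exact ⟨w, hd', pressureEquation_of_affine hΦ hl hlr hr haff,
    ⟨⟨-w, hd'.sub_const _, hneg t1⟩, ⟨-w, hd'.add_const _, hneg t2⟩⟩, t1, t2⟩

/-- The pressure vanishes outside of the patches and at their free boundary. -/
theorem IsPressureSlice.eq_zero_outside {α β a₁ b₁ a₂ b₂ : ℝ} {dp ρ₁ ρ₂ P : ℝ → ℝ}
    (h : IsPressureSlice α β dp ρ₁ ρ₂ P) (h₂ : a₂ < b₂) (h₁₂ : b₂ ≤ a₁) (h₁ : a₁ < b₁)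
    (hρ₁ : ρ₁ =ᵐ[volume.restrict (Ioc α β)] (Ioo a₁ b₁).indicator 1)
    (hρ₂ : ρ₂ =ᵐ[volume.restrict (Ioc α β)] (Ioo a₂ b₂).indicator 1) {x : ℝ} (hx : x ∈ Ioo α β)
    (hx₁ : x ∉ Ioo a₁ b₁) (hx₂ : x ∉ Ioo a₂ b₂) (hxc : ¬(x = b₂ ∧ x = a₁)) : P x = 0 := by
  -- On an interval that avoids both patches, complementarity reads `P = 0` a.e., and continuity
  -- extends this to the endpoints. Every admissible `x` is an endpoint of such an interval; only
  -- the contact point has none.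
  have key : ∀ u v, α ≤ u → u < v → v ≤ β → (∀ y ∈ Ioo u v, y ∉ Ioo a₁ b₁ ∧ y ∉ Ioo a₂ b₂) →
      x ∈ Icc u v → P x = 0 := by
    intro u v hu huv hv hout hxm
    refine Measure.eqOn_Icc_of_ae_eq (g := fun _ => (0 : ℝ)) volume huv.ne ?_
      (h.continuousOn.mono (Icc_subset_Icc hu hv)) continuousOn_const hxm
    rw [← restrict_Ioo_eq_restrict_Icc]
    have hsub : Ioo u v ⊆ Ioc α β := fun y hy => ⟨hu.trans_lt hy.1, hy.2.le.trans hv⟩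
    filter_upwards [ae_restrict_of_ae_restrict_of_subset hsub hρ₁,
      ae_restrict_of_ae_restrict_of_subset hsub hρ₂,
      ae_restrict_of_ae_restrict_of_subset hsub h.compl, ae_restrict_mem measurableSet_Ioo]
      with y h1 h2 h3 hy
    rw [h1, h2, indicator_of_notMem (hout y hy).1, indicator_of_notMem (hout y hy).2] at h3
    simpa using h3
  simp only [mem_Ioo, not_and_or, not_lt] at hx₁ hx₂ key
  rcases le_or_gt x a₂ with hxa | hxa
  · exact key α x le_rfl hx.1 hx.2.le (fun y hy => ⟨Or.inl (by linarith [hy.2]),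
      Or.inl (by linarith [hy.2])⟩) ⟨hx.1.le, le_rfl⟩
  have hxb : b₂ ≤ x := hx₂.resolve_left (not_le.2 hxa)
  rcases le_or_gt b₁ x with hxb1 | hxb1
  · exact key x β hx.1.le hx.2 le_rfl (fun y hy => ⟨Or.inr (by linarith [hy.1]),
      Or.inr (by linarith [hy.1])⟩) ⟨le_rfl, hx.2.le⟩
  have hxa1 : x ≤ a₁ := hx₁.resolve_right (not_le.2 hxb1)
  rcases hxb.eq_or_lt with heq | hlt
  · have hxa1' : x < a₁ := hxa1.lt_of_ne fun h => hxc ⟨heq.symm, h⟩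
    refine key x (min a₁ β) hx.1.le (lt_min hxa1' hx.2) (min_le_right _ _) (fun y hy => ⟨Or.inl ?_,
      Or.inr (by linarith [hy.1])⟩) ⟨le_rfl, (lt_min hxa1' hx.2).le⟩
    exact hy.2.le.trans (min_le_left _ _)
  · refine key (max b₂ α) x (le_max_right _ _) (max_lt hlt hx.1) hx.2.le
      (fun y hy => ⟨Or.inl (by linarith [hy.2]), Or.inr ?_⟩) ⟨(max_lt hlt hx.1).le, le_rfl⟩
    exact (le_max_left _ _).trans hy.1.le

end Laws

/-! ### The initial configuration -/

section Initial

theorem le_of_support_ordered {α β c₁ d₁ c₂ d₂ : ℝ} {ρ₁₀ ρ₂₀ : ℝ → ℝ} (hcd₁ : c₁ < d₁)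
    (hcd₂ : c₂ < d₂) (hA₁ : Ioo c₁ d₁ ⊆ Ioo α β) (hA₂ : Ioo c₂ d₂ ⊆ Ioo α β)
    (hρ₁₀ : ρ₁₀ =ᵐ[volume.restrict (Ioo α β)] (Ioo c₁ d₁).indicator 1)
    (hρ₂₀ : ρ₂₀ =ᵐ[volume.restrict (Ioo α β)] (Ioo c₂ d₂).indicator 1)
    (h : ∀ᵐ x ∂(volume.restrict (Ioo α β)), ∀ᵐ y ∂(volume.restrict (Ioo α β)),
      0 < ρ₁₀ x → 0 < ρ₂₀ y → y < x) : d₂ ≤ c₁ := by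
  by_contra! hlt
  -- If `c₁ < d₂`, the first patch has points below `μ` and the second has points above it, in sets
  -- of positive measure, against the order.
  obtain ⟨μ, hμ1, hμ2⟩ := exists_between hlt
  have hu : c₁ < min d₁ μ := lt_min hcd₁ hμ1
  have hv : max c₂ μ < d₂ := max_lt hcd₂ hμ2
  have e1 : ∀ᵐ x, x ∈ Ioo c₁ (min d₁ μ) → ∀ᵐ y ∂(volume.restrict (Ioo α β)),
      0 < ρ₂₀ y → y < x := by
    filter_upwards [(ae_restrict_iff' measurableSet_Ioo).1 h,
      (ae_restrict_iff' measurableSet_Ioo).1 hρ₁₀] with x h1 h2 hx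
    have hx1 : x ∈ Ioo c₁ d₁ := ⟨hx.1, hx.2.trans_le (min_le_left _ _)⟩
    have hx2 := h2 (hA₁ hx1)
    rw [indicator_of_mem hx1] at hx2
    filter_upwards [h1 (hA₁ hx1)] with y hy
    exact hy (by rw [hx2]; exact one_pos)
  obtain ⟨x, hx, hxy⟩ := exists_mem_Ioo_of_ae hu e1
  have e2 : ∀ᵐ y, y ∈ Ioo (max c₂ μ) d₂ → y < x := by
    filter_upwards [(ae_restrict_iff' measurableSet_Ioo).1 hxy,
      (ae_restrict_iff' measurableSet_Ioo).1 hρ₂₀] with y h1 h2 hy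
    have hy1 : y ∈ Ioo c₂ d₂ := ⟨(le_max_left _ _).trans_lt hy.1, hy.2⟩
    have hy2 := h2 (hA₂ hy1)
    rw [indicator_of_mem hy1] at hy2
    exact h1 (hA₂ hy1) (by rw [hy2]; exact one_pos)
  obtain ⟨y, hy, hyx⟩ := exists_mem_Ioo_of_ae hv e2
  have h1 := (le_max_right c₂ μ).trans_lt hy.1
  have h2 := hx.2.trans_le (min_le_right d₁ μ)
  linarith

/-- On the right patch the distribution function of the left one has already reached `M₂`, so the
functional starts at its maximal value. -/
theorem overlap_of_ordered_patches {α β c₁ d₁ c₂ d₂ M₁ M₂ : ℝ} {f₁ f₂ : ℝ → ℝ} (hαβ : α ≤ β)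
    (h₂ : IntervalIntegrable f₂ volume α β) (m₁ : ∫ x in α..β, f₁ x = M₁)
    (m₂ : ∫ x in α..β, f₂ x = M₂)
    (hf₁ : f₁ =ᵐ[volume.restrict (Ioc α β)] (Ioo c₁ d₁).indicator 1)
    (hf₂ : f₂ =ᵐ[volume.restrict (Ioc α β)] (Ioo c₂ d₂).indicator 1) (hle : d₂ ≤ c₁) :
    ∫ x in α..β, (∫ y in α..x, f₂ y) * f₁ x = M₁ * M₂ := by
  rw [mul_comm, ← m₁, ← intervalIntegral.integral_const_mul]
  refine intervalIntegral.integral_congr_ae ((ae_restrict_iff' measurableSet_uIoc).1 ?_)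
  rw [uIoc_of_le hαβ]
  filter_upwards [hf₁, ae_restrict_mem measurableSet_Ioc] with x hx hxm
  by_cases hxc : x ∈ Ioo c₁ d₁
  · have hsub : ∀ u v, α ≤ u → u ≤ v → v ≤ β → IntervalIntegrable f₂ volume u v :=
      fun u v h1 h2 h3 => h₂.mono_set (by
        rw [uIcc_of_le h2, uIcc_of_le hαβ]; exact Icc_subset_Icc h1 h3)
    have hadd := intervalIntegral.integral_add_adjacent_intervals
      (hsub α x le_rfl hxm.1.le hxm.2) (hsub x β hxm.1.le hxm.2 le_rfl)
    have hz : ∫ y in x..β, f₂ y = 0 := by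
      rw [intervalIntegral.integral_of_le hxm.2]
      refine integral_eq_zero_of_ae ?_
      filter_upwards [ae_restrict_of_ae_restrict_of_subset (Ioc_subset_Ioc_left hxm.1.le) hf₂,
        ae_restrict_mem measurableSet_Ioc] with y hy hym
      rw [hy, indicator_of_notMem fun h => ?_]
      · rfl
      · linarith [h.2, hym.1, hxc.1]
    rw [hz, add_zero, m₂] at hadd
    rw [hadd]
  · rw [hx, indicator_of_notMem hxc]
    simp

end Initial

end CrossDiffusion

end

/-! ### Assembly -/

open CrossDiffusion in
theorem proposition4p9
    (T α β M₁ M₂ : ℝ) (hT : 0 < T)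
    (Φ₁ Φ₂ ρ₁₀ ρ₂₀ : ℝ → ℝ) (ρ₁ ρ₂ p : ℝ → ℝ → ℝ)
    (hord : CrossDiffusion.OrderedSetting α β Φ₁ Φ₂ ρ₁₀ ρ₂₀)
    (hsol : CrossDiffusion.IsWeakSolution T α β M₁ M₂ Φ₁ Φ₂ ρ₁₀ ρ₂₀ ρ₁ ρ₂ p)
    (hΦ₁ : ConvexOn ℝ (Ioo α β) Φ₁) (hΦ₂ : ConvexOn ℝ (Ioo α β) Φ₂)
    (c₁ d₁ c₂ d₂ : ℝ) (hcd₁ : c₁ < d₁) (hcd₂ : c₂ < d₂)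
    (hA₁ : Ioo c₁ d₁ ⊆ Ioo α β) (hA₂ : Ioo c₂ d₂ ⊆ Ioo α β)
    (hρ₁₀ : ρ₁₀ =ᵐ[volume.restrict (Ioo α β)] (Ioo c₁ d₁).indicator 1)
    (hρ₂₀ : ρ₂₀ =ᵐ[volume.restrict (Ioo α β)] (Ioo c₂ d₂).indicator 1) :
    ∃ a₁ b₁ a₂ b₂ : ℝ → ℝ,
      CrossDiffusion.IsPatch T α β ρ₁ a₁ b₁ ∧
      CrossDiffusion.IsPatch T α β ρ₂ a₂ b₂ ∧
      CrossDiffusion.IsHeleShawFlow T α β Φ₁ Φ₂ a₁ b₁ a₂ b₂ p := by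
  obtain ⟨dp, hp, hs₁, hs₂⟩ := hsol.equations
  have hαβ := hord.nonempty
  have hP₁ := hord.potential_one
  have hP₂ := hord.potential_two
  have nn₁ := ae_prod_nonneg hsol.measurable_one
    ((ae_restrict_mem measurableSet_Icc).mono fun t ht => hsol.ac2_one.nonneg t ht)
  have nn₂ := ae_prod_nonneg hsol.measurable_two
    ((ae_restrict_mem measurableSet_Icc).mono fun t ht => hsol.ac2_two.nonneg t ht)
  have hf₁ := isFlow_of_solvesTransport hαβ hP₁ hsol.ac2_one hsol.measurable_one (by
    filter_upwards [hsol.sum_le_one, nn₂] with z h1 h2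
    linarith) hp hs₁
  have hf₂ := isFlow_of_solvesTransport hαβ hP₂ hsol.ac2_two hsol.measurable_two (by
    filter_upwards [hsol.sum_le_one, nn₁] with z h1 h2
    linarith) hp hs₂
  set K₁ : ℝ → ℝ → ℝ := fun τ x => (dp τ x + deriv Φ₁ x) * ρ₁ τ x with hK₁
  set K₂ : ℝ → ℝ → ℝ := fun τ x => (dp τ x + deriv Φ₂ x) * ρ₂ τ x with hK₂
  have h0T : (0 : ℝ) ∈ Icc 0 T := ⟨le_rfl, hT.le⟩
  have hi₁ : ρ₁ 0 =ᵐ[volume.restrict (Ioc α β)] (Ioo c₁ d₁).indicator 1 := by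
    rw [← restrict_Ioo_eq_restrict_Ioc]
    exact hsol.initial_one.trans hρ₁₀
  have hi₂ : ρ₂ 0 =ᵐ[volume.restrict (Ioc α β)] (Ioo c₂ d₂).indicator 1 := by
    rw [← restrict_Ioo_eq_restrict_Ioc]
    exact hsol.initial_two.trans hρ₂₀
  obtain ⟨hαc₁, hdβ₁⟩ := (Ioo_subset_Ioo_iff hcd₁).1 hA₁
  obtain ⟨hαc₂, hdβ₂⟩ := (Ioo_subset_Ioo_iff hcd₂).1 hA₂
  have hM₁ : M₁ = d₁ - c₁ := by
    rw [← hf₁.mass 0 h0T]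
    simpa using integral_indicator_Ioo_mul hcd₁.le hαc₁ hdβ₁ hi₁ fun _ => 1
  have hM₂ : M₂ = d₂ - c₂ := by
    rw [← hf₂.mass 0 h0T]
    simpa using integral_indicator_Ioo_mul hcd₂.le hαc₂ hdβ₂ hi₂ fun _ => 1
  have hM₁0 : 0 < M₁ := by linarith
  have hM₂0 : 0 < M₂ := by linarith
  have hdc : d₂ ≤ c₁ :=
    le_of_support_ordered hcd₁ hcd₂ hA₁ hA₂ hρ₁₀ hρ₂₀ hord.support_ordered
  have hsep : ∀ t ∈ Icc 0 T, ∃ z ∈ Icc α β, (∀ᵐ x, x ∈ Ioc α z → ρ₁ t x = 0) ∧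
      ∀ᵐ x, x ∈ Ioc z β → ρ₂ t x = 0 := by
    intro t ht
    have hmono := hf₁.overlap_mono hf₂ hT (by
      filter_upwards [ae_restrict_mem measurableSet_Ioc] with τ hτ
      filter_upwards [hf₁.nonneg τ (Ioc_subset_Icc_self hτ),
        hf₂.nonneg τ (Ioc_subset_Icc_self hτ), (by
          rw [← restrict_Ioo_eq_restrict_Ioc]
          exact ae_restrict_mem measurableSet_Ioo :
            ∀ᵐ x ∂volume.restrict (Ioc α β), x ∈ Ioo α β)] with x n1 n2 hx
      have := mul_nonneg n1 n2
      have := hord.drift_ordered x hx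
      simp only [hK₁, hK₂]
      -- The pressure terms cancel in `K₂ρ₁ - K₁ρ₂`, leaving `(Φ₂' - Φ₁') ρ₁ ρ₂`.
      nlinarith) ht
    rw [overlap_of_ordered_patches hαβ.le (hf₂.integrable 0 h0T) (hf₁.mass 0 h0T)
      (hf₂.mass 0 h0T) hi₁ hi₂ hdc] at hmono
    obtain ⟨z, hz, z1, z2⟩ := exists_separating_point hαβ.le (hf₁.integrable t ht)
      (hf₂.integrable t ht) (hf₁.nonneg t ht) (hf₂.nonneg t ht) (hf₁.mass t ht) (hf₂.mass t ht)
      hM₁0 hmono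
    exact ⟨z, hz, ae_eq_zero_of_integral_eq_zero le_rfl hz.1 hz.2 (hf₁.integrable t ht)
      (hf₁.nonneg t ht) z1, ae_eq_zero_of_integral_eq_zero hz.1 hz.2 le_rfl (hf₂.integrable t ht)
      (hf₂.nonneg t ht) z2⟩
  have hslice := hsol.ae_slice hαβ hp
  have hne : ∀ᵐ x ∂volume.restrict (Ioc α β), x ∈ Ioo α β := by
    rw [← restrict_Ioo_eq_restrict_Ioc]
    exact ae_restrict_mem measurableSet_Ioo
  have hcon₁ := hf₁.ae_contraction (ρ' := ρ₂) hT hM₁0 hP₁ hΦ₁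
    (hslice.mono fun t ⟨P, _, hP⟩ => ⟨P, hP⟩) (fun t ht => by
      obtain ⟨z, hz, z1, z2⟩ := hsep t ht
      refine ⟨z, β, hz.1, le_rfl, z2.mono fun x hx hxm => hx ⟨hxm.1, hxm.2.le⟩, ?_⟩
      filter_upwards [hne, ae_restrict_of_ae z1] with x hx h1 hxm
      exact h1 ⟨hx.1, not_lt.1 fun h => hxm ⟨h, hx.2⟩⟩)
  have hcon₂ := hf₂.ae_contraction (ρ' := ρ₁) hT hM₂0 hP₂ hΦ₂
    (hslice.mono fun t ⟨P, _, hP⟩ => ⟨P, hP.symm⟩) (fun t ht => by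
      obtain ⟨z, hz, z1, z2⟩ := hsep t ht
      refine ⟨α, z, le_rfl, hz.2, z1.mono fun x hx hxm => hx ⟨hxm.1, hxm.2.le⟩, ?_⟩
      -- The separating point `z` belongs neither to the open interval `(α, z)` nor to the set where
      -- `ρ₂` is known to vanish, so it is discarded as a null set.
      filter_upwards [hne, ae_restrict_of_ae z2,
        ae_restrict_of_ae (show ∀ᵐ x : ℝ, x ≠ z from compl_mem_ae_iff.2 (measure_singleton z))]
        with x hx h1 hxz hxm
      exact h1 ⟨lt_of_le_of_ne (not_lt.1 fun h => hxm ⟨hx.1, h⟩) hxz.symm, hx.2.le⟩)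
  set x₁ := barycenter α β M₁ ρ₁ K₁ with hx₁
  set x₂ := barycenter α β M₂ ρ₂ K₂ with hx₂
  have hpatch₁ : ∀ t ∈ Icc 0 T, _ := fun t ht => hf₁.eq_patch hT hcd₁ hA₁ hi₁ hM₁ hcon₁ ht
  have hpatch₂ : ∀ t ∈ Icc 0 T, _ := fun t ht => hf₂.eq_patch hT hcd₂ hA₂ hi₂ hM₂ hcon₂ ht
  -- The separating point lies between the patches: each has positive length and cannot meet the
  -- side where its density vanishes.
  have hle : ∀ t ∈ Icc 0 T, x₂ t + M₂ / 2 ≤ x₁ t - M₁ / 2 := by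
    intro t ht
    obtain ⟨z, hz, z1, z2⟩ := hsep t ht
    obtain ⟨l1, r1, e1⟩ := hpatch₁ t ht
    obtain ⟨l2, r2, e2⟩ := hpatch₂ t ht
    have k1 := disjoint_of_ae_zero l1 r1 e1 z1
    have k2 := disjoint_of_ae_zero l2 r2 e2 z2
    rw [max_eq_left l1, min_le_iff] at k1
    rw [min_eq_left r2, le_max_iff] at k2
    have k1' := k1.resolve_left (by linarith)
    have k2' := k2.resolve_left (by linarith)
    exact k2'.trans k1'
  refine ⟨fun t => x₁ t - M₁ / 2, fun t => x₁ t + M₁ / 2, fun t => x₂ t - M₂ / 2,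
    fun t => x₂ t + M₂ / 2, fun t ht => ?_, fun t ht => ?_, ⟨hle, ?_, ?_, ?_⟩⟩
  · obtain ⟨l1, r1, e1⟩ := hpatch₁ t ht
    rw [← restrict_Ioo_eq_restrict_Ioc] at e1
    exact ⟨by linarith, Ioo_subset_Ioo l1 r1, e1⟩
  · obtain ⟨l2, r2, e2⟩ := hpatch₂ t ht
    rw [← restrict_Ioo_eq_restrict_Ioc] at e2
    exact ⟨by linarith, Ioo_subset_Ioo l2 r2, e2⟩
  · simp only [sub_eq_add_neg]
    exact ⟨hf₁.absolutelyContinuous_barycenter hT.le _, hf₁.absolutelyContinuous_barycenter hT.le _⟩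
  · simp only [sub_eq_add_neg]
    exact ⟨hf₂.absolutelyContinuous_barycenter hT.le _, hf₂.absolutelyContinuous_barycenter hT.le _⟩
  · rw [← restrict_Ioo_eq_restrict_Ioc (a := (0 : ℝ))] at hslice
    filter_upwards [hslice, hf₁.ae_phase_law hT hM₁0 hP₁ hx₁ hpatch₁,
      hf₂.ae_phase_law hT hM₂0 hP₂ hx₂ hpatch₂, ae_restrict_mem measurableSet_Ioo]
      with t ⟨P, hpP, hP⟩ hl₁ hl₂ htm
    have ht := Ioo_subset_Icc_self htm
    obtain ⟨w₁, hd₁, hpe₁, hv₁, hr₁, -⟩ := hl₁ _ _ hP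
    obtain ⟨w₂, hd₂, hpe₂, hv₂, -, hr₂⟩ := hl₂ _ _ hP.symm
    refine ⟨P, hP.continuousOn, ?_, hP.nonneg, fun x hx n1 n2 n3 => ?_, hpe₁, hpe₂, hv₁, hv₂,
      fun hcontact => ?_⟩
    · rw [restrict_Ioo_eq_restrict_Ioc]
      exact hpP
    · exact hP.eq_zero_outside (by linarith) (hle t ht) (by linarith) (hpatch₁ t ht).2.2
        (hpatch₂ t ht).2.2 hx n1 n2 n3
    -- The gap is nonnegative at all times and zero at contact. Its derivative `w₂ - w₁` therefore
    -- vanishes, and the fluxes match.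
    · have hmin : IsLocalMin ((fun s => x₁ s - M₁ / 2) - fun s => x₂ s + M₂ / 2) t := by
        filter_upwards [Ioo_mem_nhds htm.1 htm.2] with s hs
        have := hle s (Ioo_subset_Icc_self hs)
        simp only [Pi.sub_apply]
        linarith
      have h0 := hmin.hasDerivAt_eq_zero ((hd₁.sub_const (M₁ / 2)).sub (hd₂.add_const (M₂ / 2)))
      have hw : w₂ = w₁ := by linarith
      exact ⟨w₁, hr₁, hw ▸ hr₂⟩
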